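/- A \emph{tree-like tableau} of size $n$ is a Young diagram (English convention) in which $n$ cells contain a point, such that the top left cell contains a point (the root); every other point has a point above it in its column or a point to its left in its row, but not both; and every row and every column contains a point. The edges of its Southeast border are numbered $1,2,\dots$ from the Southwest end to the Northeast end; write $e_i$ for the $i$-th one (there are $n+1$ of them). A \emph{corner} is a cell whose bottom and right edges are both border edges. The \emph{special point} of a tableau is the right-most point among those lying in the bottom cell of a column, and $sp$ is the index of the horizontal border edge under it. \emph{Insertion at $e_i$}: if $e_i$ is horizontal (resp. vertical), insert a row (resp. column) of cells just below (resp. just to the right of) $e_i$, starting at the left (resp. top) border and ending below (resp. to the right of) $e_i$, and put a point in its right-most (resp. bottom) cell. If $i<sp$, moreover add along the Southeast border the ribbon of empty cells that starts just to the right of the new point and ends just below the special point of the original tableau. Let $T$ be a tree-like tableau of size $n$. Then $T$ is obtained in exactly one way from the tree-like tableau of size $1$ by $n-1$ successive insertions, at edges of indices $m_2,\dots,m_n$, say; put $m_1=1$. For $2\le k\le n$ let $p_k$ be the point of $T$ that was added by the $(k-1)$-th insertion. There is exactly one permutation $\sigma=\phi(T)$ of $\{1,\dots,n\}$ whose non-inversion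 table is $(m_1-1,\dots,m_n-1)$, that is, with $\#\{i<j:\sigma(i)<\sigma(j)\}=m_j-1$ for all $1\le j\le n$. For every $k\in\{2,\dots,n\}$, the point $p_k$ lies in a corner of $T$ if and only if the following two conditions hold: \begin{enumerate} \item $\sigma(k-1)=\sigma(k)+1$ or $\sigma(k-1)<\sigma(k)$; \item $\sigma(j)>\sigma(k)+1$ for all $j$ with $k<j\le n$. \end{enumerate} -/

import Mathlib

/-- A tree-like tableau: a Young diagram (cell `(x, y)` is in row `x`, counted downwards from `0`,
and in column `y`, counted rightwards from `0`), some of whose cells hold a point. -/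
@[ext]
structure TreeLikeTableau where
  /-- the underlying Young diagram -/
  shape : YoungDiagram
  /-- the cells that hold a point -/
  points : Finset (ℕ × ℕ)
  points_subset : points ⊆ shape.cells
  /-- the top left cell holds a point, the root point -/
  root_mem : (0, 0) ∈ points
  /-- every other point has a point above it or a point to its left, but not both -/
  parent : ∀ q ∈ points, q ≠ (0, 0) →
    Xor (∃ x < q.1, (x, q.2) ∈ points) (∃ y < q.2, (q.1, y) ∈ points)
  /-- every row contains a point -/
  row_nonempty : ∀ q ∈ shape.cells, ∃ y, (q.1, y) ∈ points
  /-- every column contains a point -/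
  col_nonempty : ∀ q ∈ shape.cells, ∃ x, (x, q.2) ∈ points

/-- An edge of the Southeast border: the horizontal one at the bottom of column `c`, or the
vertical one at the right end of row `r`. -/
inductive BorderEdge where
  | horizontal (c : ℕ)
  | vertical (r : ℕ)

namespace TreeLikeTableau

/-- The size of a tree-like tableau is its number of points. -/
def size (T : TreeLikeTableau) : ℕ := T.points.card

/-- A corner: a cell whose bottom edge and right edge are both border edges. -/
def IsCorner (T : TreeLikeTableau) (q : ℕ × ℕ) : Prop :=
  q ∈ T.shape.cells ∧ (q.1 + 1, q.2) ∉ T.shape.cells ∧ (q.1, q.2 + 1) ∉ T.shape.cells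

/-- `e` is a border edge of `T`: its column, respectively its row, is one of those of `T`. -/
def IsBorderEdge (T : TreeLikeTableau) : BorderEdge → Prop
  | .horizontal c => (0, c) ∈ T.shape.cells
  | .vertical r => (r, 0) ∈ T.shape.cells

/-- The index of a border edge, when the Southeast border is travelled from its Southwest end to
its Northeast end and its edges are numbered `1, 2, …`. Before the horizontal edge of column `c`
come the `c` horizontal edges of the columns to its left and the vertical edges of the rows
`T.shape.colLen c, …, T.shape.colLen 0 - 1`; before the vertical edge of row `r` come
`T.shape.rowLen r` horizontal edges and the vertical edges of the
`T.shape.colLen 0 - r - 1` rows below. -/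
def edgeIndex (T : TreeLikeTableau) : BorderEdge → ℕ
  | .horizontal c => c + (T.shape.colLen 0 - T.shape.colLen c) + 1
  | .vertical r => T.shape.rowLen r + (T.shape.colLen 0 - r)

/-- The special point: the right-most point among those in the bottom cell of a column. -/
def IsSpecialPoint (T : TreeLikeTableau) (s : ℕ × ℕ) : Prop :=
  s ∈ T.points ∧ (s.1 + 1, s.2) ∉ T.shape.cells ∧
    ∀ q ∈ T.points, (q.1 + 1, q.2) ∉ T.shape.cells → q.2 ≤ s.2

/-- Where a cell of `T` goes when a row is inserted just below the horizontal edge `e`, or a column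
is inserted just to the right of the vertical edge `e`. -/
def shift (T : TreeLikeTableau) : BorderEdge → ℕ × ℕ → ℕ × ℕ
  | .horizontal c, q => if q.1 < T.shape.colLen c then q else (q.1 + 1, q.2)
  | .vertical r, q => if q.2 < T.shape.rowLen r then q else (q.1, q.2 + 1)

/-- The cells of the inserted row, which starts at the left border and ends below `e`, or of the
inserted column, which starts at the top border and ends to the right of `e`. -/
def newCells (T : TreeLikeTableau) : BorderEdge → Finset (ℕ × ℕ)
  | .horizontal c => (Finset.range (c + 1)).image fun y => (T.shape.colLen c, y)
  | .vertical r => (Finset.range (r + 1)).image fun x => (x, T.shape.rowLen r)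

/-- The new point: the right-most cell of the inserted row, or the bottom cell of the inserted
column. -/
def newPoint (T : TreeLikeTableau) : BorderEdge → ℕ × ℕ
  | .horizontal c => (T.shape.colLen c, c)
  | .vertical r => (r, T.shape.rowLen r)

/-- The cells of the diagram after the insertion of a row or a column at `e`, before any ribbon
is added. -/
def enlarged (T : TreeLikeTableau) (e : BorderEdge) : Finset (ℕ × ℕ) :=
  T.shape.cells.image (T.shift e) ∪ T.newCells e

/-- The ribbon along the Southeast border of the set of cells `D`, from the cell just to the right
of `p` to the cell just below `s`: the cells outside `D` whose upper left neighbour is in `D`, in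
the columns to the right of `p` up to that of `s` and in the rows below `s` down to that of `p`. -/
def ribbon (D : Finset (ℕ × ℕ)) (p s : ℕ × ℕ) : Finset (ℕ × ℕ) :=
  (D.image fun q => (q.1 + 1, q.2 + 1)).filter fun q =>
    q ∉ D ∧ p.2 < q.2 ∧ q.2 ≤ s.2 ∧ s.1 < q.1 ∧ q.1 ≤ p.1

/-- `T'` is obtained from `T` by the insertion algorithm at the border edge `e`: a row or a column
is inserted at `e` with a point in its last cell and, if `e` comes before the horizontal edge under
the special point `s` of `T`, a ribbon of empty cells is added from the new point to `s`. -/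
def IsInsertion (T : TreeLikeTableau) (e : BorderEdge) (T' : TreeLikeTableau) : Prop :=
  T.IsBorderEdge e ∧
  T'.points = insert (T.newPoint e) (T.points.image (T.shift e)) ∧
  ∃ s, T.IsSpecialPoint s ∧
    T'.shape.cells =
      if T.edgeIndex (.horizontal s.2) ≤ T.edgeIndex e then T.enlarged e
      else T.enlarged e ∪ ribbon (T.enlarged e) (T.newPoint e) (T.shift e s)

/-- `BuiltBy m k T p`: the tableau `T` is obtained from the tree-like tableau of size `1` by
`k - 1` successive insertions, at the border edges of indices `m 2, …, m k`; and for `1 ≤ j ≤ k`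
the cell of `T` that holds the `j`-th point of this construction (the root for `j = 1`, the point
added by the insertion at the edge of index `m j` for `j ≥ 2`) is `p j`. -/
inductive BuiltBy (m : ℕ → ℕ) : ℕ → TreeLikeTableau → (ℕ → ℕ × ℕ) → Prop
  | start (T : TreeLikeTableau) (h : T.size = 1) : BuiltBy m 1 T fun _ => (0, 0)
  | step (k : ℕ) (T T' : TreeLikeTableau) (p : ℕ → ℕ × ℕ) (e : BorderEdge)
      (hT : BuiltBy m k T p) (he : T.edgeIndex e = m (k + 1)) (hT' : T.IsInsertion e T') :
      BuiltBy m (k + 1) T' fun j => if j = k + 1 then T.newPoint e else T.shift e (p j)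

/-- `(m 1, …, m n)` is the insertion code of `T`, where `n` is the size of `T`, and
`p 1, …, p n` are the cells of the points of `T` in the order of insertion. By convention
`m 1 = 1`, and `m` is extended by `0` outside `{1, …, n}`. -/
def HasInsertionCode (T : TreeLikeTableau) (m : ℕ → ℕ) (p : ℕ → ℕ × ℕ) : Prop :=
  BuiltBy m T.size T p ∧ m 1 = 1 ∧ ∀ k ∉ Finset.Icc 1 T.size, m k = 0

end TreeLikeTableau

/-- The `j`-th entry of the non-inversion table of `σ(1) σ(2) … σ(n)`: the number of `i < j` such
that `σ(i) < σ(j)`. -/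
def nonInversions (σ : Equiv.Perm ℕ) (j : ℕ) : ℕ :=
  ((Finset.Ico 1 j).filter fun i => σ i < σ j).card

/-- `σ` is a permutation of `{1, …, n}` (extended by the identity to `ℕ`) whose non-inversion table
is `(m 1 - 1, …, m n - 1)`. -/
def HasNonInversionTable (n : ℕ) (m : ℕ → ℕ) (σ : Equiv.Perm ℕ) : Prop :=
  (∀ i ∉ Finset.Icc 1 n, σ i = i) ∧ ∀ j ∈ Finset.Icc 1 n, nonInversions σ j + 1 = m j

/-! The insertion code mediates between corners and the permutation.

Tableau side. The point just inserted is the special point of the new tableau: any old point further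
to the right either had a cell below it or gets one from the ribbon (`IsInsertion.isSpecialPoint`).
The edge under the new point has the index of the insertion edge. So before `p_k` is inserted, `sp`
equals `m_{k-1}`; a ribbon, which starts against the right side of the new point, occurs iff `m_k <
m_{k-1}`. Thus `p_k` is born in a corner iff `m_{k-1} ≤ m_k`. As long as it stays in one, the two
edges of that corner have indices `m_k` and `m_k + 1`. An insertion at one of these edges puts a
cell against the corner; an earlier one has its new point to the left, so the corner is covered from
below; a later one changes neither the corner nor its index (`IsInsertion.isCorner_shift`,
`IsInsertion.edgeIndex_shift`). Hence `p_k` ends in a corner iff `m_{k-1} ≤ m_k` and `m_i ≥ m_k + 2`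
for all `i > k` (`BuiltBy.isCorner_iff`).

Permutation side. `PermutesIcc.nonInversions_iff` rewrites these inequalities in terms of `σ` by
comparing sets of smaller earlier values.

The code is well defined because the last insertion can be undone in exactly one way
(`exists_isInsertion`, `IsInsertion.unique`): its point is the special point, a ribbon was added iff
that point is not in a corner, and the parent of the point tells a row from a column. A permutation
is recovered from its non-inversion table by fixing its last value. -/

namespace TreeLikeTableau

/-! ### Diagrams enlarged by a row or a column -/

variable (T : TreeLikeTableau)

theorem mem_of_le {x y x' y' : ℕ} (h : (x, y) ∈ T.shape.cells) (hx : x' ≤ x) (hy : y' ≤ y) :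
    (x', y') ∈ T.shape.cells :=
  T.shape.up_left_mem hx hy h

theorem mem_iff_lt_colLen {x y : ℕ} : (x, y) ∈ T.shape.cells ↔ x < T.shape.colLen y :=
  YoungDiagram.mem_iff_lt_colLen

theorem mem_iff_lt_rowLen {x y : ℕ} : (x, y) ∈ T.shape.cells ↔ y < T.shape.rowLen x :=
  YoungDiagram.mem_iff_lt_rowLen

theorem lt_colLen_iff_lt_rowLen {x y : ℕ} : x < T.shape.colLen y ↔ y < T.shape.rowLen x := by
  rw [← mem_iff_lt_colLen, mem_iff_lt_rowLen]

theorem zero_mem : (0, 0) ∈ T.shape.cells := T.points_subset T.root_mem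

theorem mem_enlarged_horizontal {c x y : ℕ} :
    (x, y) ∈ T.enlarged (.horizontal c) ↔
      (x < T.shape.colLen c ∧ (x, y) ∈ T.shape.cells) ∨ (x = T.shape.colLen c ∧ y ≤ c) ∨
        (T.shape.colLen c < x ∧ (x - 1, y) ∈ T.shape.cells) := by
  simp only [enlarged, shift, newCells, Finset.mem_union, Finset.mem_image, Finset.mem_range,
    Prod.exists, Prod.mk.injEq]
  constructor
  · rintro (⟨u, v, h, h'⟩ | ⟨v, h, h', h''⟩)
    · split_ifs at h' with hu
      · grind
      · simp only [Prod.mk.injEq] at h'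
        obtain ⟨rfl, rfl⟩ := h'
        exact Or.inr (Or.inr ⟨by omega, by simpa using h⟩)
    · omega
  · rintro (⟨h, h'⟩ | ⟨h, h'⟩ | ⟨h, h'⟩)
    · exact Or.inl ⟨x, y, h', by simp [h]⟩
    · exact Or.inr ⟨y, by omega, h.symm, rfl⟩
    · refine Or.inl ⟨x - 1, y, h', ?_⟩
      rw [if_neg (by omega)]
      simp only [Prod.mk.injEq, and_true]
      omega

theorem mem_enlarged_vertical {r x y : ℕ} :
    (x, y) ∈ T.enlarged (.vertical r) ↔
      (y < T.shape.rowLen r ∧ (x, y) ∈ T.shape.cells) ∨ (y = T.shape.rowLen r ∧ x ≤ r) ∨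
        (T.shape.rowLen r < y ∧ (x, y - 1) ∈ T.shape.cells) := by
  simp only [enlarged, shift, newCells, Finset.mem_union, Finset.mem_image, Finset.mem_range,
    Prod.exists, Prod.mk.injEq]
  constructor
  · rintro (⟨u, v, h, h'⟩ | ⟨v, h, h', h''⟩)
    · split_ifs at h' with hu
      · grind
      · simp only [Prod.mk.injEq] at h'
        obtain ⟨rfl, rfl⟩ := h'
        exact Or.inr (Or.inr ⟨by omega, by simpa using h⟩)
    · omega
  · rintro (⟨h, h'⟩ | ⟨h, h'⟩ | ⟨h, h'⟩)
    · exact Or.inl ⟨x, y, h', by simp [h]⟩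
    · exact Or.inr ⟨x, by omega, rfl, h.symm⟩
    · refine Or.inl ⟨x, y - 1, h', ?_⟩
      rw [if_neg (by omega)]
      simp only [Prod.mk.injEq, true_and]
      omega

/-- A finite set of cells closed under moving up and to the left. -/
def IsLower (D : Finset (ℕ × ℕ)) : Prop :=
  ∀ ⦃x y x' y' : ℕ⦄, (x, y) ∈ D → x' ≤ x → y' ≤ y → (x', y') ∈ D

theorem isLower_shape : IsLower T.shape.cells := fun _ _ _ _ h hx hy => T.mem_of_le h hx hy

theorem isLower_enlarged (e : BorderEdge) : IsLower (T.enlarged e) := by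
  intro x y x' y' h hx hy
  cases e with
  | horizontal c =>
    rw [mem_enlarged_horizontal] at h ⊢
    have key : ∀ u v, (u, v) ∈ T.shape.cells ↔ u < T.shape.colLen v := fun u v => T.mem_iff_lt_colLen
    have a1 := T.shape.colLen_anti y' y hy
    have a2 : y ≤ c → T.shape.colLen c ≤ T.shape.colLen y := T.shape.colLen_anti y c
    have a3 : c ≤ y → T.shape.colLen y ≤ T.shape.colLen c := T.shape.colLen_anti c y
    simp only [key] at h ⊢
    have a4 : ¬ y' ≤ c → T.shape.colLen y' ≤ T.shape.colLen c :=
      fun h => T.shape.colLen_anti c y' (by omega)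
    omega
  | vertical r =>
    rw [mem_enlarged_vertical] at h ⊢
    have key : ∀ u v, (u, v) ∈ T.shape.cells ↔ v < T.shape.rowLen u := fun u v => T.mem_iff_lt_rowLen
    have a1 := T.shape.rowLen_anti x' x hx
    have a2 : x ≤ r → T.shape.rowLen r ≤ T.shape.rowLen x := T.shape.rowLen_anti x r
    have a3 : r ≤ x → T.shape.rowLen x ≤ T.shape.rowLen r := T.shape.rowLen_anti r x
    simp only [key] at h ⊢
    have a4 : ¬ x' ≤ r → T.shape.rowLen x' ≤ T.shape.rowLen r :=
      fun h => T.shape.rowLen_anti r x' (by omega)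
    omega

theorem newPoint_mem_enlarged (e : BorderEdge) : T.newPoint e ∈ T.enlarged e := by
  cases e with
  | horizontal c => exact T.mem_enlarged_horizontal.2 (by omega)
  | vertical r => exact T.mem_enlarged_vertical.2 (by omega)

theorem newPoint_below_notMem (e : BorderEdge) :
    ((T.newPoint e).1 + 1, (T.newPoint e).2) ∉ T.enlarged e := by
  cases e with
  | horizontal c =>
    simp only [newPoint, mem_enlarged_horizontal, mem_iff_lt_colLen, Nat.add_sub_cancel]; omega
  | vertical r =>
    simp only [newPoint, mem_enlarged_vertical, mem_iff_lt_rowLen]; omega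

theorem newPoint_right_notMem (e : BorderEdge) :
    ((T.newPoint e).1, (T.newPoint e).2 + 1) ∉ T.enlarged e := by
  cases e with
  | horizontal c =>
    simp only [newPoint, mem_enlarged_horizontal, mem_iff_lt_colLen]; omega
  | vertical r =>
    simp only [newPoint, mem_enlarged_vertical, mem_iff_lt_rowLen, Nat.add_sub_cancel]; omega

variable {T}

theorem shift_horizontal {c x y : ℕ} :
    T.shift (.horizontal c) (x, y) = if x < T.shape.colLen c then (x, y) else (x + 1, y) := rfl

theorem shift_vertical {r x y : ℕ} :
    T.shift (.vertical r) (x, y) = if y < T.shape.rowLen r then (x, y) else (x, y + 1) := rfl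

theorem shift_injective (e : BorderEdge) : Function.Injective (T.shift e) := by
  rintro ⟨x, y⟩ ⟨x', y'⟩ h
  cases e with
  | horizontal c =>
    simp only [shift_horizontal] at h
    split_ifs at h <;> simp only [Prod.mk.injEq] at h ⊢ <;> omega
  | vertical c =>
    simp only [shift_vertical] at h
    split_ifs at h <;> simp only [Prod.mk.injEq] at h ⊢ <;> omega

theorem shift_ne_newPoint (e : BorderEdge) {q : ℕ × ℕ} (hq : q ∈ T.shape.cells) :
    T.shift e q ≠ T.newPoint e := by
  obtain ⟨x, y⟩ := q
  intro h
  cases e with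
  | horizontal c =>
    rw [mem_iff_lt_colLen] at hq
    simp only [shift_horizontal, newPoint] at h
    split_ifs at h <;> simp only [Prod.mk.injEq] at h <;> omega
  | vertical c =>
    rw [mem_iff_lt_rowLen] at hq
    simp only [shift_vertical, newPoint] at h
    split_ifs at h <;> simp only [Prod.mk.injEq] at h <;> omega

theorem shift_mem_enlarged (e : BorderEdge) {q : ℕ × ℕ} (hq : q ∈ T.shape.cells) :
    T.shift e q ∈ T.enlarged e :=
  Finset.mem_union_left _ (Finset.mem_image_of_mem _ hq)

/-- If the inserted row separates the two cells, the new row itself supplies the cell below. With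
`shift_right_mem`, this shows that an old cell never becomes a corner. -/
theorem shift_below_mem (e : BorderEdge) {x y : ℕ} (hq : (x + 1, y) ∈ T.shape.cells) :
    ((T.shift e (x, y)).1 + 1, (T.shift e (x, y)).2) ∈ T.enlarged e := by
  cases e with
  | horizontal c =>
    simp only [shift_horizontal]
    split_ifs with h
    · simp only [mem_enlarged_horizontal]
      have : c ≤ y → T.shape.colLen y ≤ T.shape.colLen c := T.shape.colLen_anti c y
      rw [mem_iff_lt_colLen] at *
      omega
    · simp only [mem_enlarged_horizontal, Nat.add_sub_cancel]
      exact Or.inr (Or.inr ⟨by omega, hq⟩)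
  | vertical c =>
    have := shift_mem_enlarged (.vertical c) hq
    simp only [shift_vertical] at this ⊢
    split_ifs at this ⊢ <;> exact this

theorem shift_right_mem (e : BorderEdge) {x y : ℕ} (hq : (x, y + 1) ∈ T.shape.cells) :
    ((T.shift e (x, y)).1, (T.shift e (x, y)).2 + 1) ∈ T.enlarged e := by
  cases e with
  | horizontal c =>
    have := shift_mem_enlarged (.horizontal c) hq
    simp only [shift_horizontal] at this ⊢
    split_ifs at this ⊢ <;> exact this
  | vertical r =>
    simp only [shift_vertical]
    split_ifs with h
    · simp only [mem_enlarged_vertical]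
      have : r ≤ x → T.shape.rowLen x ≤ T.shape.rowLen r := T.shape.rowLen_anti r x
      rw [mem_iff_lt_rowLen] at *
      omega
    · simp only [mem_enlarged_vertical, Nat.add_sub_cancel]
      exact Or.inr (Or.inr ⟨by omega, hq⟩)

/-- A cell at the bottom of its column and to the right of the new point remains at the bottom of
its column. -/
theorem shift_below_notMem (e : BorderEdge) {x y : ℕ} (hq : (x, y) ∈ T.shape.cells)
    (hq' : (x + 1, y) ∉ T.shape.cells) (h : (T.newPoint e).2 < (T.shift e (x, y)).2) :
    ((T.shift e (x, y)).1 + 1, (T.shift e (x, y)).2) ∉ T.enlarged e := by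
  cases e with
  | horizontal c =>
    simp only [shift_horizontal, newPoint] at h ⊢
    have : c ≤ y → T.shape.colLen y ≤ T.shape.colLen c := T.shape.colLen_anti c y
    split_ifs at h ⊢ with hx <;> simp only [mem_enlarged_horizontal, Nat.add_sub_cancel] <;>
      simp only [mem_iff_lt_colLen] at * <;> omega
  | vertical r =>
    simp only [shift_vertical, newPoint] at h ⊢
    split_ifs at h ⊢ with hx <;> simp only [mem_enlarged_vertical, Nat.add_sub_cancel] <;>
      simp only [mem_iff_lt_rowLen] at * <;> omega

/-- The edges before the one under `(x, y)` are the horizontal ones of columns `c < y` and the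
vertical ones of rows `r > x`; a column inserted at the latter passes to the left of `(x, y)` and
pushes it right. This turns the test `i < sp` into a comparison of columns. -/
theorem edgeIndex_lt_iff {e : BorderEdge} (he : T.IsBorderEdge e) {x y : ℕ}
    (hq : (x, y) ∈ T.shape.cells) (hq' : (x + 1, y) ∉ T.shape.cells) :
    T.edgeIndex e < T.edgeIndex (.horizontal y) ↔ (T.newPoint e).2 < (T.shift e (x, y)).2 := by
  have hc : T.shape.colLen y = x + 1 := by
    rw [mem_iff_lt_colLen] at hq hq'; omega
  have h0 := T.shape.colLen_anti 0 y (Nat.zero_le _)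
  cases e with
  | horizontal c =>
    have h0' := T.shape.colLen_anti 0 c (Nat.zero_le _)
    simp only [edgeIndex, newPoint, shift_horizontal, hc]
    have a1 : c ≤ y → T.shape.colLen y ≤ T.shape.colLen c := T.shape.colLen_anti c y
    have a2 : y ≤ c → T.shape.colLen c ≤ T.shape.colLen y := T.shape.colLen_anti y c
    have : (if x < T.shape.colLen c then (x, y) else (x + 1, y)).2 = y := by split_ifs <;> rfl
    rw [this]
    omega
  | vertical r =>
    simp only [edgeIndex, newPoint, shift_vertical, hc]
    have hr : r < T.shape.colLen 0 := T.mem_iff_lt_colLen.1 he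
    have a1 := T.lt_colLen_iff_lt_rowLen (x := r) (y := y)
    rw [hc] at a1
    split_ifs <;> dsimp only <;> omega

end TreeLikeTableau

/-! ### Ribbons, and the effect of one insertion on special point and corners -/

namespace TreeLikeTableau

theorem mem_ribbon {D : Finset (ℕ × ℕ)} {p s : ℕ × ℕ} {x y : ℕ} :
    (x, y) ∈ ribbon D p s ↔ (0 < x ∧ 0 < y ∧ (x - 1, y - 1) ∈ D) ∧
      (x, y) ∉ D ∧ p.2 < y ∧ y ≤ s.2 ∧ s.1 < x ∧ x ≤ p.1 := by
  simp only [ribbon, Finset.mem_filter, Finset.mem_image, Prod.exists, Prod.mk.injEq]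
  refine and_congr_left fun _ => ⟨?_, ?_⟩
  · rintro ⟨u, v, h, rfl, rfl⟩
    exact ⟨by omega, by omega, h⟩
  · rintro ⟨h1, h2, h3⟩
    exact ⟨x - 1, y - 1, h3, by omega, by omega⟩

/-- `p` is a corner of the diagram `E` and `s` is a cell at the bottom of a column of `E` to the
right of `p`, so that a ribbon can be added to `E` from `p` to `s`. -/
structure RibbonData (E : Finset (ℕ × ℕ)) (p s : ℕ × ℕ) : Prop where
  lower : IsLower E
  mem : p ∈ E
  below : (p.1 + 1, p.2) ∉ E
  right : (p.1, p.2 + 1) ∉ E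
  mem' : s ∈ E
  below' : (s.1 + 1, s.2) ∉ E
  lt : p.2 < s.2

namespace RibbonData

variable {E : Finset (ℕ × ℕ)} {p s : ℕ × ℕ} (h : RibbonData E p s)
include h

theorem fst_lt {x y : ℕ} (hq : (x, y) ∈ E) (hy : p.2 < y) : x < p.1 := by
  by_contra hx
  exact h.right (h.lower hq (by omega) (by omega))

theorem below_mem_ribbon {x y : ℕ} (hq : (x, y) ∈ E) (hq' : (x + 1, y) ∉ E) (hy : p.2 < y)
    (hy' : y ≤ s.2) : (x + 1, y) ∈ ribbon E p s := by
  have h1 := h.fst_lt hq hy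
  refine mem_ribbon.2 ⟨⟨by omega, by omega, h.lower hq (by omega) (by omega)⟩, hq', hy, hy', ?_, h1⟩
  by_contra hs
  exact hq' (h.lower h.mem' (by omega) hy')

theorem below_end_mem_ribbon : (s.1 + 1, s.2) ∈ ribbon E p s :=
  h.below_mem_ribbon h.mem' h.below' h.lt le_rfl

theorem right_start_mem_ribbon : (p.1, p.2 + 1) ∈ ribbon E p s := by
  have h1 := h.fst_lt h.mem' h.lt
  have h2 := h.lt
  exact mem_ribbon.2 ⟨⟨by omega, by omega, h.lower h.mem (by omega) (by omega)⟩, h.right,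
    by omega, by omega, h1, le_rfl⟩

theorem below_start_notMem : (p.1 + 1, p.2) ∉ E ∪ ribbon E p s := by
  rw [Finset.mem_union, mem_ribbon]
  have := h.below
  grind

theorem diag_end_notMem : (s.1 + 1, s.2 + 1) ∉ E ∪ ribbon E p s := by
  rw [Finset.mem_union, mem_ribbon]
  have : (s.1 + 1, s.2 + 1) ∉ E := fun h' => h.below' (h.lower h' le_rfl (by omega))
  simp only [this, false_or]
  omega

/-- The ribbon contains the missing lower right neighbour of every cell of `E` in these columns
strictly below `s`, so no such cell is left on the rim. -/
theorem not_rim {x y : ℕ} (hq : (x, y) ∈ E) (hq' : (x + 1, y + 1) ∉ E ∪ ribbon E p s)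
    (hy : p.2 < y) (hy' : y ≤ s.2) : x ≤ s.1 := by
  by_contra hx
  have h1 := h.fst_lt hq hy
  have h2 : y ≠ s.2 := by
    rintro rfl
    exact h.below' (h.lower hq (by omega) le_rfl)
  apply hq'
  rw [Finset.mem_union, mem_ribbon]
  by_cases h3 : (x + 1, y + 1) ∈ E
  · exact Or.inl h3
  · exact Or.inr ⟨⟨by omega, by omega, hq⟩, h3, by omega, by omega, by omega, by omega⟩

/-- The ribbon can be peeled off knowing only the full diagram, `p` and `s`: it consists of the rim
cells in the columns after `p` up to `s` and strictly below `s`. -/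
theorem mem_iff {x y : ℕ} : (x, y) ∈ E ↔ (x, y) ∈ E ∪ ribbon E p s ∧
    ¬ ((x + 1, y + 1) ∉ E ∪ ribbon E p s ∧ p.2 < y ∧ y ≤ s.2 ∧ s.1 < x) := by
  constructor
  · intro hq
    refine ⟨Finset.mem_union_left _ hq, fun ⟨h1, h2, h3, h4⟩ => ?_⟩
    have := h.not_rim hq h1 h2 h3
    omega
  · rintro ⟨h1, h2⟩
    rcases Finset.mem_union.1 h1 with h1 | h1
    · exact h1
    · rw [mem_ribbon] at h1
      exfalso
      refine h2 ⟨?_, by omega, by omega, by omega⟩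
      rw [Finset.mem_union, mem_ribbon, not_or]
      exact ⟨fun h3 => h1.2.1 (h.lower h3 (by omega) (by omega)), fun h3 => h1.2.1 h3.1.2.2⟩

omit h in
-- By `mem_iff` only `s = s'` is at stake. Both lie on the rim of `D`, with a cell of `D` below
-- them. By `not_rim`, the end in the column further left is not lower than the other one; were the
-- columns different, the cell below the right-hand end would force the lower right neighbour of the
-- left-hand end into `D`.
theorem unique {E E' D : Finset (ℕ × ℕ)} {p s s' : ℕ × ℕ} (h : RibbonData E p s)
    (h' : RibbonData E' p s') (hE : D = E ∪ ribbon E p s) (hE' : D = E' ∪ ribbon E' p s')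
    (hD : IsLower D) (hs : s' ∈ E) (hs' : s ∈ E') : E = E' := by
  have e1 := h.diag_end_notMem
  have e2 := h'.diag_end_notMem
  have b1 := Finset.mem_union_right E h.below_end_mem_ribbon
  have b2 := Finset.mem_union_right E' h'.below_end_mem_ribbon
  rw [← hE] at e1 b1
  rw [← hE'] at e2 b2
  have n1 := h.not_rim hs (hE ▸ e2) h'.lt
  have n2 := h'.not_rim hs' (hE' ▸ e1) h.lt
  have c1 : ¬ (s.2 < s'.2 ∧ s.1 ≤ s'.1) := fun hc =>
    e1 (hD b2 (by omega) (by omega))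
  have c2 : ¬ (s'.2 < s.2 ∧ s'.1 ≤ s.1) := fun hc =>
    e2 (hD b1 (by omega) (by omega))
  have : s = s' := by
    rw [Prod.ext_iff]; omega
  subst this
  ext ⟨x, y⟩
  rw [h.mem_iff, h'.mem_iff, ← hE, ← hE']

end RibbonData

/-- The diagram after an insertion, given the special point of the tableau before. -/
theorem IsInsertion.shape_cases {T T' : TreeLikeTableau} {e : BorderEdge}
    (h : T.IsInsertion e T') :
    ∃ s, T.IsSpecialPoint s ∧
      ((T.edgeIndex (.horizontal s.2) ≤ T.edgeIndex e ∧
          (T.shift e s).2 ≤ (T.newPoint e).2 ∧ T'.shape.cells = T.enlarged e) ∨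
        (T.edgeIndex e < T.edgeIndex (.horizontal s.2) ∧
          RibbonData (T.enlarged e) (T.newPoint e) (T.shift e s) ∧
          T'.shape.cells = T.enlarged e ∪ ribbon (T.enlarged e) (T.newPoint e) (T.shift e s))) := by
  obtain ⟨he, -, s, hs, hD⟩ := h
  refine ⟨s, hs, ?_⟩
  have hsm := T.points_subset hs.1
  have key := edgeIndex_lt_iff he hsm hs.2.1
  split_ifs at hD with hi
  · exact Or.inl ⟨hi, by rw [← not_lt] at hi ⊢; rwa [← key], hD⟩
  · rw [not_le] at hi
    have hlt := key.1 hi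
    exact Or.inr ⟨hi, ⟨T.isLower_enlarged e, T.newPoint_mem_enlarged e, T.newPoint_below_notMem e,
      T.newPoint_right_notMem e, shift_mem_enlarged e hsm, shift_below_notMem e hsm hs.2.1 hlt, hlt⟩,
      hD⟩

variable {T T' : TreeLikeTableau} {e : BorderEdge}

theorem IsSpecialPoint.unique {s s' : ℕ × ℕ} (h : T.IsSpecialPoint s) (h' : T.IsSpecialPoint s') :
    s = s' := by
  obtain ⟨x, y⟩ := s
  obtain ⟨x', y'⟩ := s'
  have h1 := h.2.2 _ h'.1 h'.2.1
  have h2 := h'.2.2 _ h.1 h.2.1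
  have h3 := T.mem_iff_lt_colLen.1 (T.points_subset h.1)
  have h4 := T.mem_iff_lt_colLen.1 (T.points_subset h'.1)
  have h5 := mt T.mem_iff_lt_colLen.2 h.2.1
  have h6 := mt T.mem_iff_lt_colLen.2 h'.2.1
  dsimp only at *
  obtain rfl : y = y' := by omega
  rw [Prod.mk.injEq]
  omega

theorem exists_isSpecialPoint (T : TreeLikeTableau) : ∃ s, T.IsSpecialPoint s := by
  classical
  have hne : (T.points.filter fun q => (q.1 + 1, q.2) ∉ T.shape.cells).Nonempty := by
    have h0 := T.mem_iff_lt_colLen.1 T.zero_mem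
    -- A point of the last row is at the bottom of its column.
    obtain ⟨y, hy⟩ := T.row_nonempty (T.shape.colLen 0 - 1, 0) (T.mem_iff_lt_colLen.2 (by omega))
    refine ⟨_, Finset.mem_filter.2 ⟨hy, fun h => ?_⟩⟩
    have := T.mem_iff_lt_colLen.1 (T.mem_of_le h le_rfl (Nat.zero_le y))
    omega
  obtain ⟨s, hs, hs'⟩ := Finset.exists_max_image _ (fun q => q.2) hne
  rw [Finset.mem_filter] at hs
  exact ⟨s, hs.1, hs.2, fun q hq hq' => hs' q (Finset.mem_filter.2 ⟨hq, hq'⟩)⟩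

theorem IsInsertion.enlarged_subset (h : T.IsInsertion e T') :
    T.enlarged e ⊆ T'.shape.cells := by
  obtain ⟨s, -, ⟨-, -, hD⟩ | ⟨-, -, hD⟩⟩ := h.shape_cases <;> rw [hD]
  exact Finset.subset_union_left

/-- A point at the bottom of its column ends up to the left of the new point, or is not at the
bottom of its column any more. -/
theorem IsInsertion.shift_below_mem_of_lt (h : T.IsInsertion e T') {x y : ℕ}
    (hq : (x, y) ∈ T.points) (hlt : (T.newPoint e).2 < (T.shift e (x, y)).2) :
    ((T.shift e (x, y)).1 + 1, (T.shift e (x, y)).2) ∈ T'.shape.cells := by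
  by_cases hq' : (x + 1, y) ∈ T.shape.cells
  · exact h.enlarged_subset (shift_below_mem e hq')
  have hqm := T.points_subset hq
  obtain ⟨⟨u, v⟩, hs, hD⟩ := h.shape_cases
  have hle : y ≤ v := hs.2.2 _ hq hq'
  have hle' : (T.shift e (x, y)).2 ≤ (T.shift e (u, v)).2 := by
    cases e with
    | horizontal c =>
      simp only [shift_horizontal]; split_ifs <;> exact hle
    | vertical r =>
      simp only [shift_vertical]; split_ifs <;> dsimp only <;> omega
  rcases hD with ⟨-, h1, -⟩ | ⟨-, hr, hD⟩
  · omega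
  · rw [hD]
    exact Finset.mem_union_right _ (hr.below_mem_ribbon (shift_mem_enlarged e hqm)
      (shift_below_notMem e hqm hq' hlt) hlt hle')

theorem IsInsertion.newPoint_below_notMem (h : T.IsInsertion e T') :
    ((T.newPoint e).1 + 1, (T.newPoint e).2) ∉ T'.shape.cells := by
  obtain ⟨s, -, ⟨-, -, hD⟩ | ⟨-, hr, hD⟩⟩ := h.shape_cases <;> rw [hD]
  · exact T.newPoint_below_notMem e
  · exact hr.below_start_notMem

/-- The new point is the special point of the new tableau. -/
theorem IsInsertion.isSpecialPoint (h : T.IsInsertion e T') :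
    T'.IsSpecialPoint (T.newPoint e) := by
  refine ⟨by simp [h.2.1], h.newPoint_below_notMem, fun q hq hq' => ?_⟩
  rw [h.2.1, Finset.mem_insert, Finset.mem_image] at hq
  rcases hq with rfl | ⟨⟨x, y⟩, hq, rfl⟩
  · rfl
  · by_contra hlt
    exact hq' (h.shift_below_mem_of_lt hq (by omega))

/-- The new point is a corner of the enlarged diagram, and a ribbon begins with the cell just to its
right. -/
theorem IsInsertion.isCorner_newPoint (h : T.IsInsertion e T') {s : ℕ × ℕ}
    (hs : T.IsSpecialPoint s) :
    T'.IsCorner (T.newPoint e) ↔ T.edgeIndex (.horizontal s.2) ≤ T.edgeIndex e := by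
  obtain ⟨s', hs', hD⟩ := h.shape_cases
  obtain rfl := hs.unique hs'
  rcases hD with ⟨hi, -, hD⟩ | ⟨hi, hr, hD⟩ <;> simp only [IsCorner, hD]
  · simp only [hi, iff_true]
    exact ⟨T.newPoint_mem_enlarged e, T.newPoint_below_notMem e, T.newPoint_right_notMem e⟩
  · refine iff_of_false (fun hc => hc.2.2 ?_) (not_le.2 hi)
    exact Finset.mem_union_right _ hr.right_start_mem_ribbon

theorem IsInsertion.size_eq (h : T.IsInsertion e T') : T'.size = T.size + 1 := by
  rw [size, h.2.1, Finset.card_insert_of_notMem, Finset.card_image_of_injective _ (shift_injective e),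
    size]
  intro hm
  obtain ⟨q, hq, hq'⟩ := Finset.mem_image.1 hm
  exact shift_ne_newPoint e (T.points_subset hq) hq'

/-- Column `0` and row `0` are not affected by the ribbon. -/
theorem IsInsertion.mem_iff_of_eq_zero (h : T.IsInsertion e T') {x y : ℕ} (hxy : x = 0 ∨ y = 0) :
    (x, y) ∈ T'.shape.cells ↔ (x, y) ∈ T.enlarged e := by
  obtain ⟨s, -, ⟨-, -, hD⟩ | ⟨-, -, hD⟩⟩ := h.shape_cases <;> rw [hD]
  rw [Finset.mem_union, mem_ribbon]
  refine or_iff_left fun hr => ?_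
  omega

theorem IsInsertion.lengths (h : T.IsInsertion e T') :
    (T'.shape.colLen 0 = T.shape.colLen 0 + (match e with | .horizontal _ => 1 | .vertical _ => 0)) ∧
    (T'.shape.rowLen 0 = T.shape.rowLen 0 + (match e with | .horizontal _ => 0 | .vertical _ => 1)) := by
  have hc : ∀ x, x < T'.shape.colLen 0 ↔ (x, 0) ∈ T.enlarged e := fun x => by
    rw [← T'.mem_iff_lt_colLen, h.mem_iff_of_eq_zero (Or.inr rfl)]
  have hr : ∀ x, x < T'.shape.rowLen 0 ↔ (0, x) ∈ T.enlarged e := fun x => by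
    rw [← T'.mem_iff_lt_rowLen, h.mem_iff_of_eq_zero (Or.inl rfl)]
  have he := h.1
  have zc := T.mem_iff_lt_colLen.1 T.zero_mem
  have zr := T.mem_iff_lt_rowLen.1 T.zero_mem
  cases e with
  | horizontal c =>
    have hL := T.mem_iff_lt_colLen.1 he
    have h0 := T.shape.colLen_anti 0 c (Nat.zero_le _)
    constructor
    · refine eq_of_forall_lt_iff fun x => ?_
      rw [hc, mem_enlarged_horizontal, mem_iff_lt_colLen, mem_iff_lt_colLen]
      dsimp only; omega
    · refine eq_of_forall_lt_iff fun x => ?_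
      rw [hr, mem_enlarged_horizontal, mem_iff_lt_rowLen]
      dsimp only; omega
  | vertical r =>
    have hL := T.mem_iff_lt_rowLen.1 he
    have h0 := T.shape.rowLen_anti 0 r (Nat.zero_le _)
    constructor
    · refine eq_of_forall_lt_iff fun x => ?_
      rw [hc, mem_enlarged_vertical, mem_iff_lt_colLen]
      dsimp only; omega
    · refine eq_of_forall_lt_iff fun x => ?_
      rw [hr, mem_enlarged_vertical, mem_iff_lt_rowLen, mem_iff_lt_rowLen]
      dsimp only; omega

theorem edgeIndex_of_bottom {q : ℕ × ℕ} (hq : q ∈ T.shape.cells)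
    (hq' : (q.1 + 1, q.2) ∉ T.shape.cells) :
    T.edgeIndex (.horizontal q.2) = q.2 + (T.shape.colLen 0 - q.1) ∧ q.1 < T.shape.colLen 0 := by
  obtain ⟨x, y⟩ := q
  have h0 := T.shape.colLen_anti 0 y (Nat.zero_le _)
  rw [mem_iff_lt_colLen] at hq hq'
  simp only [edgeIndex] at *
  omega

/-- The edge below the new point has the index of the edge of the insertion. -/
theorem IsInsertion.edgeIndex_newPoint (h : T.IsInsertion e T') :
    T'.edgeIndex (.horizontal (T.newPoint e).2) = T.edgeIndex e := by
  have h1 := (edgeIndex_of_bottom (h.enlarged_subset (T.newPoint_mem_enlarged e))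
    h.newPoint_below_notMem).1
  rw [h1, h.lengths.1]
  have he := h.1
  cases e with
  | horizontal c =>
    have h0 := T.shape.colLen_anti 0 c (Nat.zero_le _)
    simp only [newPoint, edgeIndex]; omega
  | vertical r => rfl

theorem edgeIndex_mem_Icc (he : T.IsBorderEdge e) :
    1 ≤ T.edgeIndex e ∧ T.edgeIndex e + 1 ≤ T.shape.rowLen 0 + T.shape.colLen 0 + 1 := by
  cases e with
  | horizontal c =>
    have h1 := T.mem_iff_lt_rowLen.1 he
    have h2 := T.mem_iff_lt_colLen.1 he
    have h0 := T.shape.colLen_anti 0 c (Nat.zero_le _)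
    simp only [edgeIndex]; omega
  | vertical r =>
    have h1 := T.mem_iff_lt_rowLen.1 he
    have h2 := T.mem_iff_lt_colLen.1 he
    have h0 := T.shape.rowLen_anti 0 r (Nat.zero_le _)
    simp only [edgeIndex]; omega

/-- Whether a point in a corner remains in a corner. -/
theorem IsInsertion.isCorner_shift (h : T.IsInsertion e T') {x y : ℕ} (hq : (x, y) ∈ T.points) :
    T'.IsCorner (T.shift e (x, y)) ↔
      T.IsCorner (x, y) ∧ T.edgeIndex (.horizontal y) + 2 ≤ T.edgeIndex e := by
  have hqm := T.points_subset hq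
  by_cases hc : T.IsCorner (x, y)
  swap
  · refine iff_of_false (fun hc' => hc ⟨hqm, fun hb => ?_, fun hb => ?_⟩) fun hc' => hc hc'.1
    · exact hc'.2.1 (h.enlarged_subset (shift_below_mem e hb))
    · exact hc'.2.2 (h.enlarged_subset (shift_right_mem e hb))
  simp only [hc, true_and]
  obtain ⟨-, hb, hr⟩ := hc
  dsimp only at hb hr
  have hi := edgeIndex_of_bottom hqm hb
  dsimp only at hi
  have hL : T.shape.colLen y = x + 1 := by
    rw [mem_iff_lt_colLen] at hqm hb; omega
  have hR : T.shape.rowLen x = y + 1 := by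
    rw [mem_iff_lt_rowLen] at hqm hr; omega
  rw [hi.1]
  have hbelow := h.shift_below_mem_of_lt hq
  have hsub := h.enlarged_subset
  have hmem := hsub (shift_mem_enlarged e hqm)
  have he := h.1
  cases e with
  | horizontal c =>
    have hc0 := T.shape.colLen_anti 0 c (Nat.zero_le _)
    have hcL := T.mem_iff_lt_colLen.1 he
    simp only [edgeIndex]
    have hcx := T.lt_colLen_iff_lt_rowLen (x := x) (y := c)
    have hcx' := T.lt_colLen_iff_lt_rowLen (x := x + 1) (y := c)
    rcases lt_trichotomy c y with hlt | rfl | hlt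
    -- The new point is to the left of `(x, y)`, so that cell is covered from below.
    · refine iff_of_false (fun hc => hc.2.1 (hbelow ?_)) ?_
      · rw [shift_horizontal, if_pos (by omega)]; exact hlt
      · omega
    -- The new row passes directly under `(x, y)`.
    · refine iff_of_false (fun hc => hc.2.1 (hsub ?_)) (by omega)
      rw [shift_horizontal, if_pos (by omega), mem_enlarged_horizontal]
      dsimp only; omega
    -- The row is inserted above `(x, y)`, and any ribbon stays in columns beyond `c ≥ y + 1`.
    · refine iff_of_true ?_ (by omega)
      rw [shift_horizontal, if_neg (by omega)] at hmem ⊢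
      refine ⟨hmem, ?_, ?_⟩ <;>
      obtain ⟨s, -, ⟨-, -, hD⟩ | ⟨-, -, hD⟩⟩ := h.shape_cases <;> rw [hD] <;>
      simp only [Finset.mem_union, mem_ribbon, mem_enlarged_horizontal, Nat.add_sub_cancel, hb, hr,
        newPoint] <;> grind
  | vertical r =>
    have hc0 := T.shape.rowLen_anti 0 r (Nat.zero_le _)
    have hcL := T.mem_iff_lt_colLen.1 he
    simp only [edgeIndex]
    have hcx := T.lt_colLen_iff_lt_rowLen (x := r) (y := y)
    have hcx' := T.lt_colLen_iff_lt_rowLen (x := r) (y := y + 1)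
    have hcy := T.shape.colLen_anti y (y + 1) (Nat.le_succ _)
    rcases lt_trichotomy r x with hlt | rfl | hlt
    · refine iff_of_true ?_ (by omega)
      rw [shift_vertical, if_pos (by omega)] at hmem ⊢
      refine ⟨hmem, ?_, ?_⟩ <;>
      obtain ⟨s, -, ⟨-, -, hD⟩ | ⟨-, -, hD⟩⟩ := h.shape_cases <;> rw [hD] <;>
      simp only [Finset.mem_union, mem_ribbon, mem_enlarged_vertical, Nat.add_sub_cancel, hb, hr,
        newPoint] <;> grind
    · refine iff_of_false (fun hc => hc.2.2 (hsub ?_)) (by omega)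
      rw [shift_vertical, if_pos (by omega), mem_enlarged_vertical]
      dsimp only; omega
    · refine iff_of_false (fun hc => hc.2.1 (hbelow ?_)) ?_
      · rw [shift_vertical, if_neg (by omega)]; simp only [newPoint]; omega
      · omega

/-- The insertion takes place beyond both edges of the corner: a new row adds one both to the row of
the point and to the number of rows, a new column changes neither. -/
theorem IsInsertion.edgeIndex_shift (h : T.IsInsertion e T') {x y : ℕ} (hq : (x, y) ∈ T.points)
    (hc : T'.IsCorner (T.shift e (x, y))) :
    T'.edgeIndex (.horizontal (T.shift e (x, y)).2) = T.edgeIndex (.horizontal y) := by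
  obtain ⟨⟨hqm, hb, hr⟩, hle⟩ := (h.isCorner_shift hq).1 hc
  have hi := edgeIndex_of_bottom hqm hb
  have hi' := edgeIndex_of_bottom hc.1 hc.2.1
  dsimp only at hb hr hi
  rw [hi.1] at hle
  rw [hi'.1, hi.1, h.lengths.1]
  have hL : T.shape.colLen y = x + 1 := by
    rw [mem_iff_lt_colLen] at hqm hb; omega
  have hR : T.shape.rowLen x = y + 1 := by
    rw [mem_iff_lt_rowLen] at hqm hr; omega
  have he := h.1
  cases e with
  | horizontal c =>
    have hc0 := T.shape.colLen_anti 0 c (Nat.zero_le _)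
    have hcL := T.mem_iff_lt_colLen.1 he
    have hcx := T.lt_colLen_iff_lt_rowLen (x := x) (y := c)
    simp only [edgeIndex] at hle
    have : y < c := by
      by_contra hn
      have := T.shape.colLen_anti c y (by omega)
      omega
    rw [shift_horizontal, if_neg (by omega)]
    dsimp only; omega
  | vertical r =>
    have hcL := T.mem_iff_lt_colLen.1 he
    have hcx := T.lt_colLen_iff_lt_rowLen (x := r) (y := y)
    simp only [edgeIndex] at hle
    have : r < x := by
      by_contra hn
      have := T.shape.rowLen_anti x r (by omega)
      omega
    rw [shift_vertical, if_pos (by omega)]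
    rfl

end TreeLikeTableau

/-! ### Undoing the last insertion: uniqueness, then existence -/

namespace TreeLikeTableau

variable {T T' : TreeLikeTableau} {e : BorderEdge}

theorem shift_mem_enlarged_iff (e : BorderEdge) {q : ℕ × ℕ} :
    T.shift e q ∈ T.enlarged e ↔ q ∈ T.shape.cells := by
  refine ⟨fun h => ?_, shift_mem_enlarged e⟩
  obtain ⟨x, y⟩ := q
  cases e with
  | horizontal c =>
    rw [shift_horizontal] at h
    split_ifs at h <;> rw [mem_enlarged_horizontal] at h <;> grind
  | vertical r =>
    rw [shift_vertical] at h
    split_ifs at h <;> rw [mem_enlarged_vertical] at h <;> grind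

theorem IsInsertion.shift_mem_points (h : T.IsInsertion e T') {q : ℕ × ℕ} (hq : q ∈ T.points) :
    T.shift e q ∈ T'.points := by
  rw [h.2.1]
  exact Finset.mem_insert_of_mem (Finset.mem_image_of_mem _ hq)

theorem IsInsertion.image_shift (h : T.IsInsertion e T') :
    T.points.image (T.shift e) = T'.points.erase (T.newPoint e) := by
  rw [h.2.1, Finset.erase_insert]
  intro hm
  obtain ⟨q, hq, hq'⟩ := Finset.mem_image.1 hm
  exact shift_ne_newPoint e (T.points_subset hq) hq'

/-- Column `c` already held a point, so a point inserted with a row has one above it. A point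
inserted with a column has one to its left (`exists_left`); as both cannot occur, the two types of
insertion are distinguishable. -/
theorem IsInsertion.exists_above {c : ℕ} (h : T.IsInsertion (.horizontal c) T') :
    ∃ x < T.shape.colLen c, (x, c) ∈ T'.points := by
  obtain ⟨x, hx⟩ := T.col_nonempty _ h.1
  have hlt := T.mem_iff_lt_colLen.1 (T.points_subset hx)
  have := h.shift_mem_points hx
  rw [shift_horizontal, if_pos hlt] at this
  exact ⟨x, hlt, this⟩

theorem IsInsertion.exists_left {r : ℕ} (h : T.IsInsertion (.vertical r) T') :
    ∃ y < T.shape.rowLen r, (r, y) ∈ T'.points := by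
  obtain ⟨y, hy⟩ := T.row_nonempty _ h.1
  have hlt := T.mem_iff_lt_rowLen.1 (T.points_subset hy)
  have := h.shift_mem_points hy
  rw [shift_vertical, if_pos hlt] at this
  exact ⟨y, hlt, this⟩

theorem not_above_and_left {x y : ℕ} (h : (x, y) ∈ T.points)
    (h1 : ∃ x' < x, (x', y) ∈ T.points) (h2 : ∃ y' < y, (x, y') ∈ T.points) : False := by
  have hne : (x, y) ≠ (0, 0) := by
    obtain ⟨x', hx, -⟩ := h1
    rw [Ne, Prod.mk.injEq]; omega
  rcases T.parent _ h hne with h | h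
  · exact h.2 h2
  · exact h.2 h1

/-- The edge of an insertion, and how it moves the cells, can be read off the new tableau. -/
theorem IsInsertion.edge_unique {T₁ T₂ T' : TreeLikeTableau} {e₁ e₂ : BorderEdge}
    (h₁ : T₁.IsInsertion e₁ T') (h₂ : T₂.IsInsertion e₂ T') :
    e₁ = e₂ ∧ T₁.shift e₁ = T₂.shift e₂ := by
  have hP := h₁.isSpecialPoint.unique h₂.isSpecialPoint
  have hm := h₁.isSpecialPoint.1
  cases e₁ with
  | horizontal c =>
    cases e₂ with
    | horizontal c' =>
      simp only [newPoint, Prod.mk.injEq] at hP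
      obtain ⟨hL, rfl⟩ := hP
      refine ⟨rfl, funext fun q => ?_⟩
      simp only [shift, hL]
    | vertical r =>
      simp only [newPoint, Prod.mk.injEq] at hP hm
      have h := h₂.exists_left
      rw [← hP.2, ← hP.1] at h
      exact (not_above_and_left hm h₁.exists_above h).elim
  | vertical r =>
    cases e₂ with
    | vertical r' =>
      simp only [newPoint, Prod.mk.injEq] at hP
      obtain ⟨rfl, hL⟩ := hP
      refine ⟨rfl, funext fun q => ?_⟩
      simp only [shift, hL]
    | horizontal c =>
      simp only [newPoint, Prod.mk.injEq] at hP hm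
      have h := h₂.exists_above
      rw [← hP.1, ← hP.2] at h
      exact (not_above_and_left hm h h₁.exists_left).elim

/-- The last insertion is determined by the tableau it produces. -/
theorem IsInsertion.unique {T₁ T₂ T' : TreeLikeTableau} {e₁ e₂ : BorderEdge}
    (h₁ : T₁.IsInsertion e₁ T') (h₂ : T₂.IsInsertion e₂ T') : T₁ = T₂ ∧ e₁ = e₂ := by
  obtain ⟨he, hshift⟩ := h₁.edge_unique h₂
  have hP := h₁.isSpecialPoint.unique h₂.isSpecialPoint
  have hpts : T₁.points = T₂.points := by
    apply Finset.image_injective (shift_injective (T := T₁) e₁)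
    rw [h₁.image_shift, hshift, h₂.image_shift, hP]
  have hE : T₁.enlarged e₁ = T₂.enlarged e₂ := by
    obtain ⟨s₁, hs₁, hD₁⟩ := h₁.shape_cases
    obtain ⟨s₂, hs₂, hD₂⟩ := h₂.shape_cases
    -- Being a corner depends on the new tableau only, so either both insertions add a ribbon or
    -- neither does.
    have hc := h₁.isCorner_newPoint hs₁
    rw [hP, h₂.isCorner_newPoint hs₂] at hc
    rcases hD₁ with ⟨hi₁, -, hD₁⟩ | ⟨hi₁, hr₁, hD₁⟩ <;>
      rcases hD₂ with ⟨hi₂, -, hD₂⟩ | ⟨hi₂, hr₂, hD₂⟩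
    · rw [← hD₁, hD₂]
    · omega
    · omega
    -- The two tableaux have the same points, so the end of each ribbon lies in the other enlarged
    -- diagram.
    · have m₁ := shift_mem_enlarged e₁ (T₁.points_subset (hpts ▸ hs₂.1))
      have m₂ := shift_mem_enlarged e₂ (T₂.points_subset (hpts ▸ hs₁.1))
      rw [hshift] at m₁
      rw [← hshift] at m₂
      rw [← hP] at hr₂ hD₂
      exact hr₁.unique hr₂ hD₁ hD₂ T'.isLower_shape m₁ m₂
  refine ⟨TreeLikeTableau.ext ?_ hpts, he⟩
  ext q
  rw [← shift_mem_enlarged_iff e₁, hshift, hE,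
    shift_mem_enlarged_iff e₂]

theorem mem_image_swap {s : Finset (ℕ × ℕ)} {x y : ℕ} :
    (x, y) ∈ s.image Prod.swap ↔ (y, x) ∈ s := by
  simp

/-- The transpose of a tree-like tableau. -/
def transpose (T : TreeLikeTableau) : TreeLikeTableau where
  shape := T.shape.transpose
  points := T.points.image Prod.swap
  points_subset := by
    intro q hq
    obtain ⟨q, hq', rfl⟩ := Finset.mem_image.1 hq
    rw [YoungDiagram.mem_cells, YoungDiagram.mem_transpose, Prod.swap_swap]
    exact T.points_subset hq'
  root_mem := Finset.mem_image.2 ⟨_, T.root_mem, rfl⟩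
  parent := by
    intro q hq hne
    obtain ⟨⟨x, y⟩, hq', rfl⟩ := Finset.mem_image.1 hq
    have := (T.parent (x, y) hq' (fun h => hne (by rw [h]; rfl))).symm
    simp only [Prod.fst_swap, Prod.snd_swap, mem_image_swap]
    exact this
  row_nonempty := by
    intro q hq
    rw [YoungDiagram.mem_cells, YoungDiagram.mem_transpose] at hq
    simpa using T.col_nonempty _ hq
  col_nonempty := by
    intro q hq
    rw [YoungDiagram.mem_cells, YoungDiagram.mem_transpose] at hq
    simpa using T.row_nonempty _ hq

theorem mem_transpose_points {x y : ℕ} : (x, y) ∈ T.transpose.points ↔ (y, x) ∈ T.points :=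
  mem_image_swap

theorem mem_transpose_cells {x y : ℕ} :
    (x, y) ∈ T.transpose.shape.cells ↔ (y, x) ∈ T.shape.cells := by
  rw [YoungDiagram.mem_cells, transpose, YoungDiagram.mem_transpose]
  rfl

/-- Insertion of a row or a column with a new point, without a ribbon. -/
def IsRibbonlessInsertion (T : TreeLikeTableau) (e : BorderEdge) (T' : TreeLikeTableau) : Prop :=
  T.IsBorderEdge e ∧ T'.points = insert (T.newPoint e) (T.points.image (T.shift e)) ∧
    T'.shape.cells = T.enlarged e

/-- Special points, hence ribbons, are not symmetric in rows and columns; the symmetry is available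
only for this part of an insertion. -/
theorem IsRibbonlessInsertion.transpose {c : ℕ}
    (h : T.IsRibbonlessInsertion (.horizontal c) T'.transpose) :
    T.transpose.IsRibbonlessInsertion (.vertical c) T' := by
  obtain ⟨he, hp, hD⟩ := h
  have hL : T.transpose.shape.rowLen c = T.shape.colLen c := YoungDiagram.rowLen_transpose _ _
  refine ⟨mem_transpose_cells.2 he, ?_, ?_⟩
  · ext ⟨x, y⟩
    rw [← mem_transpose_points, hp]
    simp only [Finset.mem_insert, Finset.mem_image, Prod.exists, shift_horizontal, shift_vertical,
      newPoint, hL, mem_transpose_points, Prod.mk.injEq]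
    refine or_congr and_comm ?_
    rw [exists_comm]
    refine exists_congr fun u => exists_congr fun v => and_congr_right fun _ => ?_
    split_ifs <;> simp only [Prod.mk.injEq] <;> exact and_comm
  · ext ⟨x, y⟩
    rw [← mem_transpose_cells, hD, mem_enlarged_horizontal, mem_enlarged_vertical, hL,
      mem_transpose_cells, mem_transpose_cells]

/-- A point in a corner that has a point above it comes from the insertion of a row. -/
theorem exists_ribbonlessInsertion_of_above {a b : ℕ} (hp : (a, b) ∈ T'.points)
    (hb : (a + 1, b) ∉ T'.shape.cells) (hr : (a, b + 1) ∉ T'.shape.cells)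
    (habove : ∃ x < a, (x, b) ∈ T'.points) :
    ∃ T : TreeLikeTableau, T.newPoint (.horizontal b) = (a, b) ∧
      T.IsRibbonlessInsertion (.horizontal b) T' := by
  have hcell := T'.points_subset hp
  -- The point is alone in its row: it has a point above, so none to the left, and there is no cell
  -- to its right. Deleting the row therefore loses this point only.
  have hrow : ∀ y, (a, y) ∈ T'.points → y = b := by
    intro y hy
    rcases lt_trichotomy y b with h | h | h
    · exact (not_above_and_left hp habove ⟨y, h, hy⟩).elim
    · exact h
    · exact (hr (T'.mem_of_le (T'.points_subset hy) le_rfl h)).elim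
  have hcol : ∀ x, (x, b) ∈ T'.shape.cells → x ≤ a := by
    intro x hx
    by_contra h
    exact hb (T'.mem_of_le hx (by omega) le_rfl)
  have ha : 0 < a := by
    obtain ⟨x, hx, -⟩ := habove
    omega
  -- This will be the shift of the insertion; the smaller tableau is the preimage of the given one
  -- under it.
  let up : ℕ × ℕ → ℕ × ℕ := fun q => if q.1 < a then q else (q.1 + 1, q.2)
  have up_lt : ∀ {x y : ℕ}, x < a → up (x, y) = (x, y) := fun h => if_pos h
  have up_ge : ∀ {x y : ℕ}, ¬ x < a → up (x, y) = (x + 1, y) := fun h => if_neg h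
  have up_le : ∀ q, up q ∈ T'.shape.cells → q ∈ T'.shape.cells := by
    rintro ⟨x, y⟩ h
    by_cases hx : x < a
    · rwa [up_lt hx] at h
    · rw [up_ge hx] at h
      exact T'.mem_of_le h (by omega) le_rfl
  have memD : ∀ q, q ∈ T'.shape.cells.filter (fun q => up q ∈ T'.shape.cells) ↔
      up q ∈ T'.shape.cells := fun q => by
    rw [Finset.mem_filter]; exact ⟨fun h => h.2, fun h => ⟨up_le q h, h⟩⟩
  have memQ : ∀ q, q ∈ T'.shape.cells.filter (fun q => up q ∈ T'.points) ↔ up q ∈ T'.points :=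
    fun q => by
      rw [Finset.mem_filter]; exact ⟨fun h => h.2, fun h => ⟨up_le q (T'.points_subset h), h⟩⟩
  have up_snd : ∀ x y, (up (x, y)).2 = y := fun x y => by
    by_cases hx : x < a
    · rw [up_lt hx]
    · rw [up_ge hx]
  have up_fst : ∀ x y y', ((up (x, y)).1, y') = up (x, y') := fun x y y' => by
    by_cases hx : x < a
    · rw [up_lt hx, up_lt hx]
    · rw [up_ge hx, up_ge hx]
  -- The deleted point is at the bottom of its column, so it was above no other point.
  have above : ∀ x y, up (x, y) ∈ T'.shape.cells → ((∃ x' < x, up (x', y) ∈ T'.points) ↔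
      ∃ x' < (up (x, y)).1, (x', y) ∈ T'.points) := by
    intro x y hxy
    constructor
    · rintro ⟨x', hx', h⟩
      by_cases hxa' : x' < a
      · rw [up_lt hxa'] at h
        refine ⟨x', ?_, h⟩
        by_cases hxa : x < a
        · rwa [up_lt hxa]
        · rw [up_ge hxa]; exact Nat.lt_succ_of_lt hx'
      · rw [up_ge hxa'] at h
        rw [up_ge (by omega)]
        exact ⟨x' + 1, by simpa using hx', h⟩
    · rintro ⟨x', hx', h⟩
      rcases lt_trichotomy x' a with hlt | rfl | hlt
      · refine ⟨x', ?_, by rwa [up_lt hlt]⟩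
        by_cases hxa : x < a
        · rwa [up_lt hxa] at hx'
        · omega
      · obtain rfl := hrow y h
        by_cases hxa : x < x'
        · rw [up_lt hxa] at hx'; dsimp only at hx'; omega
        · rw [up_ge hxa] at hxy
          have := hcol _ hxy
          omega
      · by_cases hxa : x < a
        · rw [up_lt hxa] at hx'; dsimp only at hx'; omega
        · rw [up_ge hxa] at hx'
          dsimp only at hx'
          refine ⟨x' - 1, by omega, ?_⟩
          rw [up_ge (by omega), Nat.sub_add_cancel (by omega)]
          exact h
  let T : TreeLikeTableau :=
    { shape :=
        { cells := T'.shape.cells.filter (fun q => up q ∈ T'.shape.cells)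
          isLowerSet := by
            rintro ⟨x, y⟩ ⟨x', y'⟩ ⟨hx, hy⟩ h
            rw [Finset.mem_coe, memD] at h ⊢
            dsimp only at hx hy
            by_cases hxa : x' < a
            · rw [up_lt hxa]
              exact T'.mem_of_le (up_le _ h) hx hy
            · rw [up_ge hxa]
              rw [up_ge (by omega)] at h
              exact T'.mem_of_le h (by omega) hy }
      points := T'.shape.cells.filter (fun q => up q ∈ T'.points)
      points_subset := fun q hq => (memD q).2 (T'.points_subset ((memQ q).1 hq))
      root_mem := (memQ _).2 (by rw [up_lt ha]; exact T'.root_mem)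
      parent := by
        rintro ⟨x, y⟩ hq hne
        simp only [memQ] at hq ⊢
        have hne' : up (x, y) ≠ (0, 0) := by
          by_cases hxa : x < a
          · rwa [up_lt hxa]
          · rw [up_ge hxa, Ne, Prod.mk.injEq]; omega
        have := T'.parent _ hq hne'
        rw [up_snd] at this
        simp only [up_fst] at this
        rwa [above x y (T'.points_subset hq)]
      row_nonempty := by
        rintro ⟨x, y⟩ hq
        rw [memD] at hq
        obtain ⟨y', hy'⟩ := T'.row_nonempty _ hq
        rw [up_fst] at hy'
        exact ⟨y', (memQ _).2 hy'⟩
      col_nonempty := by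
        rintro ⟨x, y⟩ hq
        rw [memD] at hq
        obtain ⟨x', hx'⟩ := T'.col_nonempty _ hq
        rw [up_snd] at hx'
        rcases lt_trichotomy x' a with hlt | rfl | hlt
        · exact ⟨x', (memQ _).2 (by rwa [up_lt hlt])⟩
        · obtain rfl := hrow y hx'
          obtain ⟨x, hx, h⟩ := habove
          exact ⟨x, (memQ _).2 (by rwa [up_lt hx])⟩
        · refine ⟨x' - 1, (memQ _).2 ?_⟩
          rw [up_ge (by omega), Nat.sub_add_cancel (by omega)]
          exact hx' }
  have hTc : ∀ q, q ∈ T.shape.cells ↔ up q ∈ T'.shape.cells := memD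
  have hTp : ∀ q, q ∈ T.points ↔ up q ∈ T'.points := memQ
  have hL : T.shape.colLen b = a := by
    refine eq_of_forall_lt_iff fun x => ?_
    rw [← mem_iff_lt_colLen, hTc]
    by_cases hxa : x < a
    · rw [up_lt hxa]
      exact iff_of_true (T'.mem_of_le hcell hxa.le le_rfl) hxa
    · rw [up_ge hxa]
      exact iff_of_false (fun h => by have := hcol _ h; omega) hxa
  have hshift : T.shift (.horizontal b) = up := by
    funext q
    simp only [shift, hL, up]
  refine ⟨T, by simp only [newPoint, hL], ?_, ?_, ?_⟩
  · rw [IsBorderEdge, hTc, up_lt ha]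
    exact T'.mem_of_le hcell (Nat.zero_le _) le_rfl
  · ext ⟨x, y⟩
    simp only [newPoint, hL, hshift, Finset.mem_insert, Finset.mem_image, Prod.mk.injEq]
    constructor
    · intro h
      rcases lt_trichotomy x a with hlt | rfl | hlt
      · exact Or.inr ⟨(x, y), (hTp _).2 (by rwa [up_lt hlt]), up_lt hlt⟩
      · exact Or.inl ⟨rfl, hrow y h⟩
      · have : up (x - 1, y) = (x, y) := by
          rw [up_ge (by omega), Nat.sub_add_cancel (by omega)]
        exact Or.inr ⟨(x - 1, y), (hTp _).2 (by rwa [this]), this⟩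
    · rintro (⟨rfl, rfl⟩ | ⟨q, hq, hq'⟩)
      · exact hp
      · rw [← hq']; exact (hTp q).1 hq
  · ext ⟨x, y⟩
    rw [mem_enlarged_horizontal, hL, hTc, hTc]
    rcases lt_trichotomy x a with hlt | rfl | hlt
    · rw [up_lt hlt]; grind
    · have : (x, y) ∈ T'.shape.cells ↔ y ≤ b := by
        refine ⟨fun h => ?_, fun h => T'.mem_of_le hcell le_rfl h⟩
        by_contra hn
        exact hr (T'.mem_of_le h le_rfl (by omega))
      rw [this]; grind
    · have : up (x - 1, y) = (x, y) := by
        rw [up_ge (by omega), Nat.sub_add_cancel (by omega)]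
      rw [this]; grind

theorem exists_ribbonlessInsertion {a b : ℕ} (hp : (a, b) ∈ T'.points)
    (hc : T'.IsCorner (a, b)) (hne : (a, b) ≠ (0, 0)) :
    ∃ (T : TreeLikeTableau) (e : BorderEdge), T.newPoint e = (a, b) ∧
      T.IsRibbonlessInsertion e T' := by
  obtain ⟨-, hb, hr⟩ := hc
  rcases T'.parent _ hp hne with ⟨h, -⟩ | ⟨h, -⟩
  · obtain ⟨T, h⟩ := exists_ribbonlessInsertion_of_above hp hb hr h
    exact ⟨T, _, h⟩
  · obtain ⟨T, h1, h2⟩ := exists_ribbonlessInsertion_of_above (T' := T'.transpose)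
      (mem_transpose_points.2 hp) (mt mem_transpose_cells.1 hr) (mt mem_transpose_cells.1 hb)
      (by simpa only [mem_transpose_points] using h)
    refine ⟨T.transpose, .vertical a, ?_, h2.transpose⟩
    simp only [newPoint, Prod.mk.injEq] at h1 ⊢
    exact ⟨trivial, (YoungDiagram.rowLen_transpose _ _).trans h1.1⟩

/-- A tree-like tableau whose special point `p` is not in a corner arises from the addition of a
ribbon to a tree-like tableau in which `p` is in a corner. -/
theorem exists_ribbonData {p : ℕ × ℕ} (hp : T'.IsSpecialPoint p) (hc : ¬ T'.IsCorner p) :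
    ∃ (T : TreeLikeTableau) (s : ℕ × ℕ), T.points = T'.points ∧ s ∈ T.points ∧
      RibbonData T.shape.cells p s ∧
      T'.shape.cells = T.shape.cells ∪ ribbon T.shape.cells p s ∧
      ∀ q ∈ T.points, (q.1 + 1, q.2) ∉ T.shape.cells → q.2 ≤ s.2 ∨ q.2 ≤ p.2 := by
  classical
  obtain ⟨a, b⟩ := p
  obtain ⟨hp, hb, hmax⟩ := hp
  dsimp only at hb hmax
  have hcell := T'.points_subset hp
  have hr : (a, b + 1) ∈ T'.shape.cells := by
    by_contra hr
    exact hc ⟨hcell, hb, hr⟩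
  have row_le : ∀ {x y : ℕ}, (x, y) ∈ T'.shape.cells → b ≤ y → x ≤ a := by
    intro x y h hy
    by_contra hx
    exact hb (T'.mem_of_le h (by omega) hy)
  -- Candidates for the end of the ribbon: points on the rim to the right of `p`. Any point of the
  -- last column is one.
  have hne : (T'.points.filter fun q => b < q.2 ∧ (q.1 + 1, q.2 + 1) ∉ T'.shape.cells).Nonempty := by
    have h0 := T'.mem_iff_lt_rowLen.1 (T'.mem_of_le hr (Nat.zero_le _) le_rfl)
    obtain ⟨x, hx⟩ := T'.col_nonempty (0, T'.shape.rowLen 0 - 1) (T'.mem_iff_lt_rowLen.2 (by omega))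
    refine ⟨_, Finset.mem_filter.2 ⟨hx, ?_, fun h => ?_⟩⟩
    · dsimp only; omega
    · have := T'.mem_iff_lt_rowLen.1 (T'.mem_of_le h (Nat.zero_le _) le_rfl)
      omega
  -- Column minus row increases along the rim from Southwest to Northeast, so this is the first
  -- candidate met after `p`; hence the rim cells removed below hold no point.
  obtain ⟨⟨u, v⟩, hs, hmin⟩ :=
    Finset.exists_min_image _ (fun q : ℕ × ℕ => (q.2 : ℤ) - q.1) hne
  simp only [Finset.mem_filter, and_imp, Prod.forall] at hs hmin
  obtain ⟨hs, hbv, huv⟩ := hs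
  -- No point to the right of the special point is at the bottom of its column.
  have hubelow : (u + 1, v) ∈ T'.shape.cells := by
    by_contra h
    exact absurd (hmax _ hs h) (by dsimp only; omega)
  have hua := row_le hubelow hbv.le
  let R : ℕ × ℕ → Prop := fun q =>
    (q.1 + 1, q.2 + 1) ∉ T'.shape.cells ∧ b < q.2 ∧ q.2 ≤ v ∧ u < q.1
  have hsub : T'.points ⊆ T'.shape.cells.filter fun q => ¬ R q := by
    rintro ⟨x, y⟩ hq
    refine Finset.mem_filter.2 ⟨T'.points_subset hq, fun ⟨h1, h2, h3, h4⟩ => ?_⟩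
    have := hmin x y hq h2 h1
    dsimp only at *
    omega
  let E : YoungDiagram :=
    { cells := T'.shape.cells.filter fun q => ¬ R q
      isLowerSet := by
        rintro ⟨x, y⟩ ⟨x', y'⟩ ⟨hx, hy⟩ h
        simp only [Finset.coe_filter, Set.mem_ofPred_eq] at h hx hy ⊢
        obtain ⟨h, hR⟩ := h
        refine ⟨T'.mem_of_le h hx hy, fun ⟨h1, h2, h3, h4⟩ => hR ?_⟩
        dsimp only at *
        refine ⟨fun h' => h1 (T'.mem_of_le h' (by omega) (by omega)), by dsimp only; omega, ?_,
          by dsimp only; omega⟩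
        dsimp only
        by_contra hv
        exact huv (T'.mem_of_le h (by omega) (by omega)) }
  let T : TreeLikeTableau :=
    { shape := E
      points := T'.points
      points_subset := hsub
      root_mem := T'.root_mem
      parent := T'.parent
      row_nonempty := fun q hq => T'.row_nonempty q (Finset.mem_filter.1 hq).1
      col_nonempty := fun q hq => T'.col_nonempty q (Finset.mem_filter.1 hq).1 }
  have memT : ∀ x y, (x, y) ∈ T.shape.cells ↔ (x, y) ∈ T'.shape.cells ∧
      ¬ ((x + 1, y + 1) ∉ T'.shape.cells ∧ b < y ∧ y ≤ v ∧ u < x) :=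
    fun x y => Finset.mem_filter
  refine ⟨T, (u, v), rfl, hs, ⟨T.isLower_shape, hsub hp, ?_, ?_, hsub hs, ?_, hbv⟩, ?_, ?_⟩
  · rw [memT]
    exact fun h => hb h.1
  · rw [memT]
    exact fun h => h.2 ⟨fun h' => hb (T'.mem_of_le h' le_rfl (by omega)), by omega, by omega, by omega⟩
  · rw [memT]
    exact fun h => h.2 ⟨fun h' => huv (T'.mem_of_le h' (by omega) le_rfl), by omega, by omega, by omega⟩
  · ext ⟨x, y⟩
    rw [Finset.mem_union, mem_ribbon]
    constructor
    · intro h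
      by_cases hT : (x, y) ∈ T.shape.cells
      · exact Or.inl hT
      · right
        have hT' := hT
        rw [memT] at hT'
        obtain ⟨h1, h2, h3, h4⟩ : (x + 1, y + 1) ∉ T'.shape.cells ∧ b < y ∧ y ≤ v ∧ u < x := by
          by_contra hn
          exact hT' ⟨h, hn⟩
        refine ⟨⟨by omega, by omega, (memT _ _).2 ⟨T'.mem_of_le h (by omega) (by omega), fun h' => ?_⟩⟩,
          hT, h2, h3, h4, row_le h h2.le⟩
        rw [Nat.sub_add_cancel (by omega), Nat.sub_add_cancel (by omega)] at h'
        exact h'.1 h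
    · rintro (h | ⟨⟨h1, h2, h3⟩, h4, h5, h6, h7, h8⟩)
      · exact ((memT _ _).1 h).1
      · by_contra hn
        rw [memT, Nat.sub_add_cancel h1, Nat.sub_add_cancel h2] at h3
        dsimp only at *
        by_cases hy : y - 1 = b
        · exact hn (T'.mem_of_le hr h8 (by omega))
        · by_cases hx : x - 1 = u
          · exact hn (T'.mem_of_le hubelow (by omega) h6)
          · exact h3.2 ⟨hn, by omega, by omega, by omega⟩
  · rintro ⟨x, y⟩ hq hq'
    rw [memT] at hq'
    dsimp only at hq' ⊢
    by_contra! hn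
    have : (x + 1, y) ∈ T'.shape.cells := by
      by_contra h
      have := hmax _ hq h
      dsimp only at this; omega
    exact hq' ⟨this, by omega⟩

/-- Every tree-like tableau with more than one point comes from an insertion. -/
theorem exists_isInsertion (h : T'.size ≠ 1) :
    ∃ (T : TreeLikeTableau) (e : BorderEdge), T.IsInsertion e T' := by
  obtain ⟨⟨a, b⟩, hp⟩ := T'.exists_isSpecialPoint
  have hne : (a, b) ≠ (0, 0) := by
    intro h0
    rw [h0] at hp
    apply h
    rw [size, Finset.card_eq_one]
    refine ⟨(0, 0), Finset.eq_singleton_iff_unique_mem.2 ⟨T'.root_mem, ?_⟩⟩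
    -- If the root is special, column `0` has a single cell, so there is only one row and every
    -- point is at the bottom of its column.
    rintro ⟨x, y⟩ hq
    have hx : x = 0 := by
      by_contra hx
      exact hp.2.1 (T'.mem_of_le (T'.points_subset hq) (by omega) (Nat.zero_le _))
    have hy := hp.2.2 _ hq fun h' => hp.2.1 (T'.mem_of_le h' (by omega) (Nat.zero_le _))
    rw [Prod.mk.injEq]; dsimp only at hy; omega
  by_cases hc : T'.IsCorner (a, b)
  · obtain ⟨T, e, hP, he, hpts, hD⟩ := exists_ribbonlessInsertion hp.1 hc hne
    refine ⟨T, e, he, hpts, ?_⟩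
    obtain ⟨s, hs⟩ := T.exists_isSpecialPoint
    refine ⟨s, hs, ?_⟩
    rw [if_pos]
    · exact hD
    -- Otherwise the old special point would still be at the bottom of its column, to the right of
    -- the special point of `T'`.
    · rw [← not_lt, edgeIndex_lt_iff he (T.points_subset hs.1) hs.2.1]
      intro hlt
      have hb := shift_below_notMem e (T.points_subset hs.1) hs.2.1 hlt
      rw [← hD] at hb
      have := hp.2.2 _ (hpts ▸ Finset.mem_insert_of_mem (Finset.mem_image_of_mem _ hs.1)) hb
      rw [hP] at hlt
      exact absurd this (not_le.2 hlt)
  · obtain ⟨T₁, s', hpts₁, hs', hR, hD₁, hmax⟩ := exists_ribbonData hp hc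
    obtain ⟨T, e, hP, he, hpts, hD⟩ :=
      exists_ribbonlessInsertion (hpts₁ ▸ hp.1) ⟨hR.mem, hR.below, hR.right⟩ hne
    have hs'' := hs'
    rw [hpts, Finset.mem_insert, Finset.mem_image, hP] at hs''
    rcases hs'' with rfl | ⟨⟨u, v⟩, hs, rfl⟩
    · exact absurd hR.lt (lt_irrefl _)
    have hsb : (u + 1, v) ∉ T.shape.cells := fun h' =>
      hR.below' (hD ▸ shift_below_mem e h')
    -- The ribbon is removed first, then the row or column of the point, now in a corner. The end of
    -- the ribbon comes from the special point of `T`.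
    refine ⟨T, e, he, by rw [← hpts₁, hpts], (u, v), ⟨hs, hsb, ?_⟩, ?_⟩
    · rintro ⟨x, y⟩ hq hq'
      by_contra! hlt
      dsimp only at hlt
      have hle : (T.shift e (u, v)).2 < (T.shift e (x, y)).2 := by
        cases e with
        | horizontal c => simp only [shift_horizontal]; split_ifs <;> exact hlt
        | vertical r => simp only [shift_vertical]; split_ifs <;> dsimp only <;> omega
      have hlt' := hR.lt.trans hle
      rw [← hP] at hlt'
      have hb := shift_below_notMem e (T.points_subset hq) hq' hlt'
      rw [← hD] at hb
      have := hmax _ (hpts ▸ Finset.mem_insert_of_mem (Finset.mem_image_of_mem _ hq)) hb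
      rw [hP] at hlt'
      omega
    · rw [if_neg]
      · rw [← hD, hP]; exact hD₁
      · rw [not_le, edgeIndex_lt_iff he (T.points_subset hs) hsb, hP]
        exact hR.lt

end TreeLikeTableau

/-! ### Insertion codes, and corners in terms of the code -/

namespace TreeLikeTableau

variable {T : TreeLikeTableau} {m m' : ℕ → ℕ} {k : ℕ} {p : ℕ → ℕ × ℕ}

theorem eq_zero_of_size_eq_one (h : T.size = 1) {q : ℕ × ℕ} (hq : q ∈ T.points) : q = (0, 0) :=
  Finset.card_le_one.1 (le_of_eq h) _ hq _ T.root_mem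

theorem lengths_of_size_eq_one (h : T.size = 1) :
    T.shape.colLen 0 = 1 ∧ T.shape.rowLen 0 = 1 := by
  constructor
  · refine eq_of_forall_lt_iff fun x => ?_
    rw [← mem_iff_lt_colLen]
    constructor
    · intro hx
      obtain ⟨y, hy⟩ := T.row_nonempty _ hx
      have := (Prod.mk.inj (eq_zero_of_size_eq_one h hy)).1
      omega
    · intro hx
      obtain rfl : x = 0 := by omega
      exact T.zero_mem
  · refine eq_of_forall_lt_iff fun y => ?_
    rw [← mem_iff_lt_rowLen]
    constructor
    · intro hy
      obtain ⟨x, hx⟩ := T.col_nonempty _ hy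
      have := (Prod.mk.inj (eq_zero_of_size_eq_one h hx)).2
      omega
    · intro hy
      obtain rfl : y = 0 := by omega
      exact T.zero_mem

theorem BuiltBy.pos (h : BuiltBy m k T p) : 1 ≤ k := by
  cases h <;> omega

theorem BuiltBy.lengths_add (h : BuiltBy m k T p) :
    T.shape.rowLen 0 + T.shape.colLen 0 = k + 1 := by
  induction h with
  | start T h => rw [(lengths_of_size_eq_one h).1, (lengths_of_size_eq_one h).2]
  | step k T T' p e hT he hT' ih =>
    rw [hT'.lengths.1, hT'.lengths.2]
    cases e <;> dsimp only <;> omega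

/-- The last point of a construction is the special point. -/
theorem BuiltBy.isSpecialPoint (h : BuiltBy m k T p) (h1 : m 1 = 1) :
    T.IsSpecialPoint (p k) ∧ T.edgeIndex (.horizontal (p k).2) = m k := by
  cases h with
  | start T h =>
    obtain ⟨s, hs⟩ := T.exists_isSpecialPoint
    have := eq_zero_of_size_eq_one h hs.1
    subst this
    exact ⟨hs, by simp [edgeIndex, h1]⟩
  | step k T T' p e hT he hT' =>
    simp only [if_true]
    exact ⟨hT'.isSpecialPoint, by rw [hT'.edgeIndex_newPoint, he]⟩

/-- A tableau built in `k` steps has `k + 1` rows and columns in all, hence `k + 1` border edges,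
which bounds `m (k + 1)`. These are the bounds required of a non-inversion table. -/
theorem BuiltBy.code_mem (h : BuiltBy m k T p) (h1 : m 1 = 1) :
    ∀ j, 1 ≤ j → j ≤ k → 1 ≤ m j ∧ m j ≤ j := by
  induction h with
  | start T h =>
    intro j hj hj'
    obtain rfl : j = 1 := by omega
    omega
  | step k T T' p e hT he hT' ih =>
    intro j hj hj'
    rcases Nat.lt_or_ge k j with hlt | hle
    · obtain rfl : j = k + 1 := by omega
      have := edgeIndex_mem_Icc hT'.1
      have := hT.lengths_add
      omega
    · exact ih j hj hle

theorem BuiltBy.point_mem (h : BuiltBy m k T p) :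
    ∀ j, 1 ≤ j → j ≤ k → p j ∈ T.points := by
  induction h with
  | start T h => exact fun _ _ _ => T.root_mem
  | step k T T' p e hT he hT' ih =>
    intro j hj hj'
    dsimp only
    split_ifs with hk
    · exact hT'.isSpecialPoint.1
    · exact hT'.shift_mem_points (ih j hj (by omega))

theorem BuiltBy.edgeIndex_of_isCorner (h : BuiltBy m k T p) (h1 : m 1 = 1) :
    ∀ j, 1 ≤ j → j ≤ k → T.IsCorner (p j) → T.edgeIndex (.horizontal (p j).2) = m j := by
  induction h with
  | start T h =>
    intro j hj hj' _
    obtain rfl : j = 1 := by omega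
    exact ((BuiltBy.start T h).isSpecialPoint h1).2
  | step k T T' p e hT he hT' ih =>
    intro j hj hj' hc
    dsimp only at hc ⊢
    split_ifs at hc ⊢ with hk
    · rw [hT'.edgeIndex_newPoint, he, hk]
    · have hjk : j ≤ k := by omega
      have hpj := hT.point_mem j hj hjk
      rw [hT'.edgeIndex_shift hpj hc]
      exact ih j hj hjk ((hT'.isCorner_shift hpj).1 hc).1

/-- The corners that hold a point, in terms of the insertion code. -/
theorem BuiltBy.isCorner_iff (h : BuiltBy m k T p) (h1 : m 1 = 1) :
    ∀ j, 2 ≤ j → j ≤ k →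
      (T.IsCorner (p j) ↔ m (j - 1) ≤ m j ∧ ∀ i, j < i → i ≤ k → m j + 2 ≤ m i) := by
  induction h with
  | start T h => intro j hj hj'; omega
  | step k T T' p e hT he hT' ih =>
    intro j hj hj'
    dsimp only
    split_ifs with hk
    · subst hk
      obtain ⟨hs, hi⟩ := hT.isSpecialPoint h1
      -- The previous point is special, so the ribbon test compares two consecutive terms of the
      -- code.
      rw [hT'.isCorner_newPoint hs, hi, he, Nat.add_sub_cancel]
      exact (and_iff_left fun i _ _ => by omega).symm
    · have hjk : j ≤ k := by omega
      have hpj := hT.point_mem j (by omega) hjk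
      have hstep : T'.IsCorner (T.shift e (p j)) ↔ T.IsCorner (p j) ∧ m j + 2 ≤ m (k + 1) := by
        rw [hT'.isCorner_shift hpj]
        refine and_congr_right fun hc => ?_
        rw [← he, ← hT.edgeIndex_of_isCorner h1 j (by omega) hjk hc]
      rw [hstep, ih j hj hjk, and_assoc]
      refine and_congr_right fun _ => ⟨fun ⟨h2, h3⟩ i hi hi' => ?_, fun h2 => ⟨fun i hi hi' => ?_, ?_⟩⟩
      · rcases Nat.lt_or_ge k i with hlt | hle
        · obtain rfl : i = k + 1 := by omega
          exact h3
        · exact h2 i hi hle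
      · exact h2 i hi (by omega)
      · exact h2 (k + 1) (by omega) le_rfl

theorem BuiltBy.code_unique (h : BuiltBy m k T p) :
    ∀ {p' : ℕ → ℕ × ℕ}, BuiltBy m' k T p' → ∀ j, 2 ≤ j → j ≤ k → m j = m' j := by
  induction h with
  | start T h => intro p' _ j hj hj'; omega
  | step k T T' p e hT he hT' ih =>
    intro p' h' j hj hj'
    cases h' with
    | start _ h => exact absurd hT.pos (by omega)
    | step _ T₂ _ p₂ e₂ hT₂ he₂ hT₂' =>
      obtain ⟨rfl, rfl⟩ := hT'.unique hT₂'
      rcases Nat.lt_or_ge k j with hlt | hle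
      · obtain rfl : j = k + 1 := by omega
        rw [← he, ← he₂]
      · exact ih hT₂ j hj hle

theorem BuiltBy.congr (h : BuiltBy m k T p) (hm : ∀ j ≤ k, m j = m' j) : BuiltBy m' k T p := by
  induction h with
  | start T h => exact .start T h
  | step k T T' p e hT he hT' ih =>
    exact .step k T T' p e (ih fun j hj => hm j (by omega)) (he.trans (hm _ le_rfl)) hT'

theorem exists_hasInsertionCode (n : ℕ) (T : TreeLikeTableau) (hT : T.size = n) :
    ∃ m p, T.HasInsertionCode m p := by
  induction n generalizing T with
  | zero =>
    have h0 := Finset.card_eq_zero.1 hT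
    exact absurd T.root_mem (by simp [h0])
  | succ n ih =>
    by_cases hn : T.size = 1
    · refine ⟨fun j => if j = 1 then 1 else 0, fun _ => (0, 0), ?_, if_pos rfl, fun k hk => ?_⟩
      · rw [hn]; exact .start T hn
      · rw [hn, Finset.mem_Icc] at hk
        exact if_neg (by omega)
    · obtain ⟨T₀, e, h⟩ := exists_isInsertion hn
      have hs := h.size_eq
      have hn₀ : T₀.size = n := by omega
      obtain ⟨m, p, hb, h1, h0⟩ := ih T₀ hn₀
      rw [hn₀] at hb h0
      have hpos := hb.pos
      -- The code of `T₀` takes its default value `0` at `n + 1` and must be overwritten there.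
      have hb' := hb.congr (m' := fun j => if j = n + 1 then T₀.edgeIndex e else m j)
        fun j hj => (if_neg (by omega)).symm
      have hb'' := BuiltBy.step n T₀ T p e hb' (if_pos rfl).symm h
      rw [← hT] at hb''
      refine ⟨_, _, hb'', ?_, fun k hk => ?_⟩
      · rw [if_neg (by omega)]; exact h1
      · rw [hT, Finset.mem_Icc] at hk
        rw [if_neg (by omega)]
        exact h0 k (by rw [Finset.mem_Icc]; omega)

theorem existsUnique_insertionCode (T : TreeLikeTableau) :
    ∃! m : ℕ → ℕ, ∃ p : ℕ → ℕ × ℕ, T.HasInsertionCode m p := by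
  obtain ⟨m, p, h⟩ := exists_hasInsertionCode _ T rfl
  refine ⟨m, ⟨p, h⟩, ?_⟩
  rintro m' ⟨p', h'⟩
  funext j
  by_cases hj : j ∈ Finset.Icc 1 T.size
  · rw [Finset.mem_Icc] at hj
    rcases Nat.lt_or_ge 1 j with hlt | hle
    · exact h'.1.code_unique h.1 j hlt hj.2
    · obtain rfl : j = 1 := by omega
      rw [h.2.1, h'.2.1]
  · rw [h.2.2 j hj, h'.2.2 j hj]

end TreeLikeTableau

/-! ### Permutations and non-inversion tables -/

/-- `σ` permutes `{1, …, n}`. -/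
def PermutesIcc (n : ℕ) (σ : Equiv.Perm ℕ) : Prop :=
  ∀ i ∉ Finset.Icc 1 n, σ i = i

namespace PermutesIcc

variable {n : ℕ} {σ : Equiv.Perm ℕ} (h : PermutesIcc n σ)
include h

theorem symm : PermutesIcc n σ.symm := fun i hi => by
  rw [Equiv.symm_apply_eq, h i hi]

theorem mem {i : ℕ} (h1 : 1 ≤ i) (hn : i ≤ n) : 1 ≤ σ i ∧ σ i ≤ n := by
  by_contra hi
  have := h (σ i) (by rwa [Finset.mem_Icc])
  rw [σ.injective this] at hi
  exact hi ⟨h1, hn⟩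

theorem one_le {i : ℕ} (h1 : 1 ≤ i) : 1 ≤ σ i := by
  by_cases hn : i ≤ n
  · exact (h.mem h1 hn).1
  · rwa [h i (by rw [Finset.mem_Icc]; omega)]

theorem nonInversions_add_one_le {j : ℕ} (hj : 1 ≤ j) : nonInversions σ j + 1 ≤ σ j := by
  have : nonInversions σ j ≤ (Finset.Ico 1 (σ j)).card := by
    rw [nonInversions, ← Finset.card_image_of_injective _ σ.injective]
    refine Finset.card_le_card fun w hw => ?_
    obtain ⟨i, hi, rfl⟩ := Finset.mem_image.1 hw
    rw [Finset.mem_filter, Finset.mem_Ico] at hi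
    exact Finset.mem_Ico.2 ⟨h.one_le hi.1.1, hi.2⟩
  rw [Nat.card_Ico] at this
  have := h.one_le hj
  omega

/-- The positions of the values `1, …, v - 1` are all counted at `j`. -/
theorem le_nonInversions {j v : ℕ} (hv : v ≤ σ j) (hlt : ∀ w, 1 ≤ w → w < v → σ.symm w < j) :
    v ≤ nonInversions σ j + 1 := by
  have : (Finset.Ico 1 v).card ≤ nonInversions σ j := by
    rw [nonInversions, ← Finset.card_image_of_injective _ σ.symm.injective]
    refine Finset.card_le_card fun i hi => ?_
    obtain ⟨w, hw, rfl⟩ := Finset.mem_image.1 hi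
    rw [Finset.mem_Ico] at hw
    rw [Finset.mem_filter, Finset.mem_Ico, Equiv.apply_symm_apply]
    exact ⟨⟨h.symm.one_le hw.1, hlt w hw.1 hw.2⟩, by omega⟩
  rw [Nat.card_Ico] at this
  omega

theorem nonInversions_last (hn : 1 ≤ n) : nonInversions σ n + 1 = σ n := by
  refine le_antisymm (h.nonInversions_add_one_le hn) (h.le_nonInversions le_rfl fun w hw hw' => ?_)
  have h1 := h.mem hn le_rfl
  have h2 := h.symm.mem hw (by omega)
  have h3 : σ.symm w ≠ n := by
    rw [Ne, Equiv.symm_apply_eq]; omega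
  omega

/-- The conditions on the non-inversion table that characterise corners, in terms of the
permutation. -/
theorem nonInversions_iff {k : ℕ} (hk : 2 ≤ k) (hkn : k ≤ n) :
    (nonInversions σ (k - 1) ≤ nonInversions σ k ∧
        ∀ j, k < j → j ≤ n → nonInversions σ k + 2 ≤ nonInversions σ j) ↔
      (σ (k - 1) = σ k + 1 ∨ σ (k - 1) < σ k) ∧ ∀ j, k < j → j ≤ n → σ k + 1 < σ j := by
  constructor
  · rintro ⟨h1, h2⟩
    -- At the first `j > k` with `σ j < σ k`, every position counted at `j` precedes `k` and is
    -- counted at `k`, against `h2`.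
    have gt : ∀ j, k < j → j ≤ n → σ k < σ j := by
      intro j
      induction j using Nat.strong_induction_on with
      | _ j ih =>
        intro hj hjn
        by_contra hlt
        have hne : σ j ≠ σ k := σ.injective.ne (by omega)
        have := h2 j hj hjn
        have hle : nonInversions σ j ≤ nonInversions σ k := by
          refine Finset.card_le_card fun i hi => ?_
          rw [Finset.mem_filter, Finset.mem_Ico] at hi ⊢
          refine ⟨⟨hi.1.1, ?_⟩, by omega⟩
          by_contra hik
          rcases Nat.lt_or_ge k i with hki | hki
          · have := ih i hi.1.2 hki (by omega)
            omega
          · obtain rfl : i = k := by omega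
            omega
        omega
    -- If `σ j = σ k + 1`, the positions counted at `j` are `k` and some of those counted at `k`:
    -- one short of `h2`.
    have gt' : ∀ j, k < j → j ≤ n → σ k + 1 < σ j := by
      intro j hj hjn
      have hlt := gt j hj hjn
      by_contra hn
      have := h2 j hj hjn
      have hle : nonInversions σ j ≤ nonInversions σ k + 1 := by
        refine (Finset.card_le_card (t := insert k _) fun i hi => ?_).trans
          (Finset.card_insert_le _ _)
        rw [Finset.mem_filter, Finset.mem_Ico] at hi
        rw [Finset.mem_insert, Finset.mem_filter, Finset.mem_Ico]
        by_cases hik : i = k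
        · exact Or.inl hik
        · have hne : σ i ≠ σ k := σ.injective.ne hik
          refine Or.inr ⟨⟨hi.1.1, ?_⟩, by omega⟩
          by_contra hki
          have := gt i (by omega) (by omega)
          omega
      omega
    refine ⟨?_, gt'⟩
    by_contra! hcon
    have hne : σ (k - 1) ≠ σ k := σ.injective.ne (by omega)
    have hk1 := h.mem (i := k - 1) (by omega) (by omega)
    -- If `σ (k - 1) > σ k + 1`, the value `σ k + 1` occurs before `k - 1`, at a position counted at
    -- `k - 1` but not at `k`, against `h1`.
    have hi₀ := h.symm.mem (i := σ k + 1) (by omega) (by omega)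
    have hσ : σ (σ.symm (σ k + 1)) = σ k + 1 := σ.apply_symm_apply _
    generalize σ.symm (σ k + 1) = i₀ at hi₀ hσ
    have hne1 : i₀ ≠ k := by rintro rfl; omega
    have hne2 : i₀ ≠ k - 1 := by rintro rfl; omega
    have hlt : i₀ < k - 1 := by
      by_contra hn
      have := gt' i₀ (by omega) hi₀.2
      omega
    have : nonInversions σ k < nonInversions σ (k - 1) := by
      refine Finset.card_lt_card ((Finset.ssubset_iff_of_subset fun i hi => ?_).2 ⟨i₀, ?_, ?_⟩)
      · rw [Finset.mem_filter, Finset.mem_Ico] at hi ⊢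
        have : i ≠ k - 1 := by rintro rfl; omega
        omega
      · rw [Finset.mem_filter, Finset.mem_Ico]; omega
      · rw [Finset.mem_filter, Finset.mem_Ico]; omega
    omega
  · rintro ⟨h1, h2⟩
    have hkle := h.nonInversions_add_one_le (j := k) (by omega)
    refine ⟨Finset.card_le_card fun i hi => ?_, fun j hj hjn => ?_⟩
    · rw [Finset.mem_filter, Finset.mem_Ico] at hi ⊢
      have : σ i ≠ σ k := σ.injective.ne (by omega)
      omega
    · have hjn' := (h.mem (i := j) (by omega) hjn).2
      -- The values up to `σ k + 1` all occur at positions at most `k`, so `j` counts at least `σ k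
      -- + 1` of them, while `k` counts at most `σ k - 1`.
      have := h.le_nonInversions (j := j) (v := σ k + 2) (h2 j hj hjn) fun w hw hw' => by
        have hi := h.symm.mem (i := w) hw (by have := h2 j hj hjn; omega)
        by_contra hn
        have := h2 (σ.symm w) (by omega) hi.2
        rw [Equiv.apply_symm_apply] at this
        omega
      omega

end PermutesIcc

/-- The permutation that moves `n` to `v` and shifts `v, …, n - 1` up by one. -/
def moveDown (n v : ℕ) (hv : v ≤ n) : Equiv.Perm ℕ where
  toFun x := if x = n then v else if v ≤ x ∧ x < n then x + 1 else x
  invFun y := if y = v then n else if v < y ∧ y ≤ n then y - 1 else y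
  left_inv x := by dsimp only; split_ifs <;> omega
  right_inv y := by dsimp only; split_ifs <;> omega

/-- `moveDown (n + 1) v` is increasing on values at most `n`, so it preserves the comparisons among
the first `n` entries. -/
theorem nonInversions_moveDown_mul {n v : ℕ} (hv : v ≤ n + 1) {σ : Equiv.Perm ℕ}
    (h : PermutesIcc n σ) {j : ℕ} (h1 : 1 ≤ j) (hn : j ≤ n) :
    nonInversions (moveDown (n + 1) v hv * σ) j = nonInversions σ j := by
  have mono : ∀ x y, x ≤ n → y ≤ n →
      (moveDown (n + 1) v hv x < moveDown (n + 1) v hv y ↔ x < y) := by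
    intro x y hx hy
    simp only [moveDown, Equiv.coe_fn_mk]
    split_ifs <;> omega
  refine congrArg Finset.card (Finset.filter_congr fun i hi => ?_)
  rw [Finset.mem_Ico] at hi
  exact mono _ _ (h.mem hi.1 (by omega)).2 (h.mem h1 hn).2

theorem permutesIcc_moveDown_mul_iff {n v : ℕ} (h1 : 1 ≤ v) (hv : v ≤ n + 1) {σ : Equiv.Perm ℕ} :
    PermutesIcc n σ ↔ PermutesIcc (n + 1) (moveDown (n + 1) v hv * σ) ∧
      (moveDown (n + 1) v hv * σ) (n + 1) = v := by
  have fix : ∀ i, i ∉ Finset.Icc 1 (n + 1) → moveDown (n + 1) v hv i = i := by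
    intro i hi
    rw [Finset.mem_Icc] at hi
    simp only [moveDown, Equiv.coe_fn_mk]
    split_ifs <;> omega
  have last : moveDown (n + 1) v hv (n + 1) = v := if_pos rfl
  constructor
  · intro h
    constructor
    · intro i hi
      have hi' := hi
      rw [Finset.mem_Icc] at hi'
      rw [Equiv.Perm.mul_apply, h i (by rw [Finset.mem_Icc]; omega), fix i hi]
    · rw [Equiv.Perm.mul_apply, h (n + 1) (by rw [Finset.mem_Icc]; omega), last]
  · rintro ⟨h, hl⟩ i hi
    by_cases hin : i = n + 1
    · subst hin
      apply (moveDown (n + 1) v hv).injective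
      rw [last, ← Equiv.Perm.mul_apply, hl]
    · have hi' : i ∉ Finset.Icc 1 (n + 1) := by
        rw [Finset.mem_Icc] at hi ⊢; omega
      apply (moveDown (n + 1) v hv).injective
      rw [fix i hi', ← Equiv.Perm.mul_apply, h i hi']

/-- A permutation is determined by its non-inversion table, which is arbitrary. -/
theorem existsUnique_hasNonInversionTable {m : ℕ → ℕ} (n : ℕ)
    (hm : ∀ j, 1 ≤ j → j ≤ n → 1 ≤ m j ∧ m j ≤ j) :
    ∃! σ : Equiv.Perm ℕ, HasNonInversionTable n m σ := by
  induction n with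
  | zero =>
    refine ⟨1, ⟨fun _ _ => rfl, fun j hj => by rw [Finset.mem_Icc] at hj; omega⟩, fun σ h => ?_⟩
    ext i
    exact h.1 i (by rw [Finset.mem_Icc]; omega)
  | succ n ih =>
    obtain ⟨h1, hv⟩ := hm (n + 1) (by omega) le_rfl
    -- The last entry of the table forces the last value to be `m (n + 1)`; left multiplication by
    -- `moveDown` then matches the solutions for `n` with those for `n + 1`.
    have key : ∀ σ : Equiv.Perm ℕ, HasNonInversionTable n m σ ↔
        HasNonInversionTable (n + 1) m (moveDown (n + 1) (m (n + 1)) hv * σ) := by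
      intro σ
      constructor
      · rintro ⟨hσ, ht⟩
        have hσ' := (permutesIcc_moveDown_mul_iff h1 hv).1 hσ
        refine ⟨hσ'.1, fun j hj => ?_⟩
        rw [Finset.mem_Icc] at hj
        rcases Nat.lt_or_ge n j with hlt | hle
        · obtain rfl : j = n + 1 := by omega
          rw [hσ'.1.nonInversions_last hj.1, hσ'.2]
        · rw [nonInversions_moveDown_mul hv hσ hj.1 hle]
          exact ht j (Finset.mem_Icc.2 ⟨hj.1, hle⟩)
      · rintro ⟨hσ, ht⟩
        have hl := ht (n + 1) (Finset.mem_Icc.2 ⟨by omega, le_rfl⟩)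
        rw [PermutesIcc.nonInversions_last hσ (by omega)] at hl
        have hσ' := (permutesIcc_moveDown_mul_iff h1 hv).2 ⟨hσ, hl⟩
        refine ⟨hσ', fun j hj => ?_⟩
        rw [Finset.mem_Icc] at hj
        rw [← nonInversions_moveDown_mul hv hσ' hj.1 hj.2]
        exact ht j (Finset.mem_Icc.2 ⟨hj.1, by omega⟩)
    obtain ⟨σ, hσ, huniq⟩ := ih fun j hj hj' => hm j hj (by omega)
    refine ⟨_, (key σ).1 hσ, fun τ hτ => ?_⟩
    have := huniq ((moveDown (n + 1) (m (n + 1)) hv)⁻¹ * τ)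
      ((key _).2 (by rwa [mul_inv_cancel_left]))
    rw [← this, mul_inv_cancel_left]

theorem mainTheorem3 (n : ℕ) (T : TreeLikeTableau) (hT : T.size = n) :
    (∃! m : ℕ → ℕ, ∃ p : ℕ → ℕ × ℕ, T.HasInsertionCode m p) ∧
    ∀ (m : ℕ → ℕ) (p : ℕ → ℕ × ℕ), T.HasInsertionCode m p →
      (∃! σ : Equiv.Perm ℕ, HasNonInversionTable n m σ) ∧
      ∀ σ : Equiv.Perm ℕ, HasNonInversionTable n m σ →
        ∀ k : ℕ, 2 ≤ k → k ≤ n →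
          (T.IsCorner (p k) ↔
            (σ (k - 1) = σ k + 1 ∨ σ (k - 1) < σ k) ∧
              ∀ j : ℕ, k < j → j ≤ n → σ k + 1 < σ j) := by
  subst hT
  refine ⟨T.existsUnique_insertionCode, fun m p ⟨hb, h1, _⟩ =>
    ⟨existsUnique_hasNonInversionTable _ (hb.code_mem h1), fun σ ⟨hσ, ht⟩ k hk hkn => ?_⟩⟩
  rw [hb.isCorner_iff h1 k hk hkn, ← PermutesIcc.nonInversions_iff hσ hk hkn,
    ← ht (k - 1) (Finset.mem_Icc.2 ⟨by omega, by omega⟩),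
    ← ht k (Finset.mem_Icc.2 ⟨by omega, hkn⟩)]
  refine and_congr (by omega) (forall_congr' fun j => imp_congr_right fun hj =>
    imp_congr_right fun hjn => ?_)
  rw [← ht j (Finset.mem_Icc.2 ⟨by omega, hjn⟩)]
  omega
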